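/- For $k\in[0,1)$ let $$F(\varphi,k)=\int_0^\varphi\frac{dt}{\sqrt{1-k^2\sin^2t}},\qquad K(k)=F(\pi/2,k),\qquad E(k)=\int_0^{\pi/2}\sqrt{1-k^2\sin^2t}\,dt,$$ let $\operatorname{am}(\cdot,k):\mathbb R\to\mathbb R$ be the inverse of $F(\cdot,k)$, and let $\operatorname{sn}p=\sin\operatorname{am}(p,k)$, $\operatorname{cn}p=\cos\operatorname{am}(p,k)$, $\operatorname{dn}p=\sqrt{1-k^2\operatorname{sn}^2p}$, $\operatorname{E}(p)=\int_0^p\operatorname{dn}^2u\,du$ be Jacobi's functions of modulus $k$. Put $$f_1=\operatorname{sn}p\operatorname{dn}p-(2\operatorname{E}(p)-p)\operatorname{cn}p,$$ $$x_2=\operatorname{cn}p\,\bigl(2(1-k^2)\,p\operatorname{E}(p)-\operatorname{E}^2(p)-(1-k^2)p^2\bigr)+\operatorname{sn}p\operatorname{dn}p\,\bigl(\operatorname{E}(p)-(1-k^2)p\bigr),$$ $$\begin{aligned}x_1=-\operatorname{dn}p\,\Bigl(&2\operatorname{sn}p\operatorname{dn}p\operatorname{E}^3(p)+\bigl((4k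^2-5)\,p\operatorname{sn}p\operatorname{dn}p+\operatorname{cn}p\,(3-6k^2\operatorname{sn}^2p)\bigr)\operatorname{E}^2(p)\\&+\bigl((4k^2-5)\operatorname{cn}p\,(1-2k^2\operatorname{sn}^2p)\,p+\operatorname{sn}p\operatorname{dn}p\,(4p^2-1+k^2(6\operatorname{sn}^2p-4-4p^2))\bigr)\operatorname{E}(p)\\&+p\operatorname{sn}p\operatorname{dn}p\,\bigl(1-(1-k^2)p^2+k^2(4k^2-5)\operatorname{sn}^2p\bigr)\\&+2\operatorname{cn}p\,\bigl(k^2\operatorname{sn}^2p\operatorname{dn}^2p+(1-k^2)(1-2k^2\operatorname{sn}^2p)p^2\bigr)\Bigr),\end{aligned}$$ $$J_1(p,k,z)=a_0+a_1z+a_2z^2,\quad a_0=f_1x_2,\quad a_2=-k^2\operatorname{sn}p\;x_1,\quad a_0+a_1+a_2=(1-k^2)\operatorname{sn}p\;x_1 .$$ **Theorem.** The equation $2E(k)-K(k)=0$ has a unique root $k_0$ in $[0,1)$, and $k_0>0$. Let $k\in(0,1)$. For $n=1,2$ the function $f_1$ has a unique root $p_n^1=p_n^1(k)$ in the interval $(-K+2Kn,\,K+2Kn)$,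 where $K=K(k)$, and the function $x_1$ has a unique root $p_1^{x_1}$ in $(p_1^1,p_2^1)$. For every $z\in[0,1]$ the minimum $$p_1^{\mathrm{conj}}(k,z)=\min\{p>0\mid J_1(p,k,z)=0\}$$ exists, and 1. if $k<k_0$, then $p_1^{\mathrm{conj}}(k,z)\in[2K,p_1^1]$; 2. if $k=k_0$, then $p_1^{\mathrm{conj}}(k,z)=2K=p_1^1$; 3. if $k>k_0$, then $p_1^{\mathrm{conj}}(k,z)\in[p_1^1,2K]$. Moreover, for every $k\in(0,1)$ there is $\varepsilon=\varepsilon(k)>0$ such that for all $z\in[0,1]$: * (1') if $k<k_0$, then $J_1>0$ for $p\in(0,2K)$ and $J_1<0$ for $p\in(p_1^1,p_1^1+\varepsilon)$; * (2') if $k=k_0$, then $J_1>0$ for $p\in(0,2K)$ and $J_1<0$ for $p\in(2K,2K+\varepsilon)$; * (3') if $k>k_0$, then $J_1>0$ for $p\in(0,p_1^1)$, and moreover * (a) if $p_1^{x_1}\in(p_1^1,2K)$, then $J_1<0$ for $p\in(p_1^{x_1},p_1^{x_1}+\varepsilon)$; * (b) if $p_1^{x_1}=2K$, then $J_1\le0$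 at $p=2K$; * (c) if $p_1^{x_1}\in(2K,p_2^1)$, then $J_1<0$ for $p\in(2K,2K+\varepsilon)$. -/

import Mathlib

open Set

noncomputable section

namespace EulerElastica

/-- The incomplete elliptic integral of the first kind, with modulus `k` and amplitude `φ`. -/
def ellF (k φ : ℝ) : ℝ := ∫ t in (0 : ℝ)..φ, 1 / √(1 - k ^ 2 * Real.sin t ^ 2)

/-- The complete elliptic integral of the first kind, `K(k)`. -/
def ellK (k : ℝ) : ℝ := ellF k (Real.pi / 2)

/-- The complete elliptic integral of the second kind, `E(k)`. -/
def ellE (k : ℝ) : ℝ := ∫ t in (0 : ℝ)..(Real.pi / 2), √(1 - k ^ 2 * Real.sin t ^ 2)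

/-- Jacobi's amplitude: the inverse of the bijection `φ ↦ ellF k φ` of the real line
(see `ellF_bijective`). -/
def am (k : ℝ) : ℝ → ℝ := Function.invFun (ellF k)

/-- Jacobi's function `sn`. -/
def sn (k p : ℝ) : ℝ := Real.sin (am k p)

/-- Jacobi's function `cn`. -/
def cn (k p : ℝ) : ℝ := Real.cos (am k p)

/-- Jacobi's function `dn`. -/
def dn (k p : ℝ) : ℝ := √(1 - k ^ 2 * sn k p ^ 2)

/-- Jacobi's epsilon function `E(p)`, the integral of `dn²` from `0` to `p`. -/
def jacobiE (k p : ℝ) : ℝ := ∫ u in (0 : ℝ)..p, dn k u ^ 2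

/-! The inverse in the definition of `am` is a genuine one for `0 ≤ k < 1`. -/

theorem one_sub_pos {k : ℝ} (hk : k ∈ Ico (0 : ℝ) 1) (t : ℝ) :
    0 < 1 - k ^ 2 * Real.sin t ^ 2 := by
  have h1 : k ^ 2 < 1 := by nlinarith [hk.1, hk.2]
  nlinarith [Real.sin_sq_le_one t, sq_nonneg (Real.sin t), sq_nonneg k]

theorem continuous_integrand {k : ℝ} (hk : k ∈ Ico (0 : ℝ) 1) :
    Continuous fun t : ℝ => 1 / √(1 - k ^ 2 * Real.sin t ^ 2) := by
  refine continuous_const.div (by fun_prop) fun t => ?_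
  exact (Real.sqrt_pos.2 (one_sub_pos hk t)).ne'

theorem one_le_integrand {k : ℝ} (hk : k ∈ Ico (0 : ℝ) 1) (t : ℝ) :
    1 ≤ 1 / √(1 - k ^ 2 * Real.sin t ^ 2) := by
  rw [le_div_iff₀ (Real.sqrt_pos.2 (one_sub_pos hk t)), one_mul]
  exact Real.sqrt_le_one.2 (by nlinarith [sq_nonneg (k * Real.sin t)])

theorem sub_le_ellF_sub {k : ℝ} (hk : k ∈ Ico (0 : ℝ) 1) {a b : ℝ} (hab : a ≤ b) :
    b - a ≤ ellF k b - ellF k a := by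
  have hc := continuous_integrand hk
  unfold ellF
  rw [intervalIntegral.integral_interval_sub_left (hc.intervalIntegrable _ _)
    (hc.intervalIntegrable _ _)]
  calc b - a = ∫ _ in a..b, (1 : ℝ) := by simp
    _ ≤ _ := intervalIntegral.integral_mono_on hab (by simp) (hc.intervalIntegrable _ _)
        fun t _ => one_le_integrand hk t

theorem ellF_bijective {k : ℝ} (hk : k ∈ Ico (0 : ℝ) 1) : Function.Bijective (ellF k) := by
  have hmono : StrictMono (ellF k) := fun a b hab => by
    linarith [sub_le_ellF_sub hk hab.le]
  refine ⟨hmono.injective, ?_⟩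
  have h0 : ellF k 0 = 0 := by simp [ellF]
  have hc : Continuous (ellF k) :=
    intervalIntegral.continuous_primitive
      (fun a b => (continuous_integrand hk).intervalIntegrable a b) 0
  refine hc.surjective ?_ ?_
  · refine Filter.tendsto_atTop_mono' _ ?_ Filter.tendsto_id
    filter_upwards [Filter.eventually_ge_atTop 0] with x hx
    have := sub_le_ellF_sub hk hx
    simp only [id]; linarith
  · refine Filter.tendsto_atBot_mono' _ ?_ Filter.tendsto_id
    filter_upwards [Filter.eventually_le_atBot 0] with x hx
    have := sub_le_ellF_sub hk hx
    simp only [id]; linarith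

theorem ellF_am {k : ℝ} (hk : k ∈ Ico (0 : ℝ) 1) (p : ℝ) : ellF k (am k p) = p :=
  Function.rightInverse_invFun (ellF_bijective hk).2 p

/-- The function `f₁(p, k)`. -/
def f₁ (k p : ℝ) : ℝ := sn k p * dn k p - (2 * jacobiE k p - p) * cn k p

/-- The function `x₁(p)`. -/
def x₁ (k p : ℝ) : ℝ :=
  let s := sn k p;
  let c := cn k p;
  let d := dn k p;
  let E := jacobiE k p;
  -d * (2 * s * d * E ^ 3
    + ((4 * k ^ 2 - 5) * p * s * d + c * (3 - 6 * k ^ 2 * s ^ 2)) * E ^ 2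
    + ((4 * k ^ 2 - 5) * c * (1 - 2 * k ^ 2 * s ^ 2) * p
        + s * d * (4 * p ^ 2 - 1 + k ^ 2 * (6 * s ^ 2 - 4 - 4 * p ^ 2))) * E
    + p * s * d * (1 - (1 - k ^ 2) * p ^ 2 + k ^ 2 * (4 * k ^ 2 - 5) * s ^ 2)
    + 2 * c * (k ^ 2 * s ^ 2 * d ^ 2 + (1 - k ^ 2) * (1 - 2 * k ^ 2 * s ^ 2) * p ^ 2))

/-- The function `x₂(p)`. -/
def x₂ (k p : ℝ) : ℝ :=
  cn k p * (2 * (1 - k ^ 2) * p * jacobiE k p - jacobiE k p ^ 2 - (1 - k ^ 2) * p ^ 2)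
    + sn k p * dn k p * (jacobiE k p - (1 - k ^ 2) * p)

/-- The coefficient `a₀`. -/
def a₀ (k p : ℝ) : ℝ := f₁ k p * x₂ k p

/-- The coefficient `a₂`. -/
def a₂ (k p : ℝ) : ℝ := -k ^ 2 * sn k p * x₁ k p

/-- The coefficient `a₁`, given by `a₂ + a₁ + a₀ = (1 - k²) sn p x₁`. -/
def a₁ (k p : ℝ) : ℝ := (1 - k ^ 2) * sn k p * x₁ k p - a₀ k p - a₂ k p

/-- The function `J₁(p, k, z) = a₀ + a₁ z + a₂ z²`. -/
def J₁ (k z p : ℝ) : ℝ := a₀ k p + a₁ k p * z + a₂ k p * z ^ 2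

/-- The root `k₀` of the equation `2 E(k) - K(k) = 0`, `k ∈ [0, 1)`. -/
def k₀ : ℝ := sInf {k : ℝ | k ∈ Ico (0 : ℝ) 1 ∧ 2 * ellE k - ellK k = 0}

/-- The roots of `f₁` in the interval `(-K + 2Kn, K + 2Kn)`. -/
def rootsF₁ (k : ℝ) (n : ℕ) : Set ℝ :=
  {p : ℝ | p ∈ Ioo (-ellK k + 2 * ellK k * n) (ellK k + 2 * ellK k * n) ∧ f₁ k p = 0}

/-- `pF₁ k n` is the root `p_n^1` of `f₁` in the interval `(-K + 2Kn, K + 2Kn)`. -/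
def pF₁ (k : ℝ) (n : ℕ) : ℝ := sInf (rootsF₁ k n)

/-- The roots of `x₁` in the interval `(p_n^1, p_{n+1}^1)`. -/
def rootsX₁ (k : ℝ) (n : ℕ) : Set ℝ :=
  {p : ℝ | p ∈ Ioo (pF₁ k n) (pF₁ k (n + 1)) ∧ x₁ k p = 0}

/-- `pX₁ k n` is the root `p_n^{x₁}` of `x₁` in the interval `(p_n^1, p_{n+1}^1)`. -/
def pX₁ (k : ℝ) (n : ℕ) : ℝ := sInf (rootsX₁ k n)

/-- The positive roots of `J₁` for fixed `k` and `z`. -/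
def rootsJ₁ (k z : ℝ) : Set ℝ := {p : ℝ | 0 < p ∧ J₁ k z p = 0}

/-- The first positive root `p_1^conj(k, z)` of `J₁`. -/
def pConj (k z : ℝ) : ℝ := sInf (rootsJ₁ k z)

end EulerElastica

end

noncomputable section

namespace EulerElastica

/-! Collecting terms turns J₁ into (1 - z) f₁ x₂ + z (1 - k² z) sn x₁ (`J₁_eq`). For z in [0, 1]
both weights are nonnegative and never vanish together, so J₁ has a known sign, whatever z is,
wherever f₁ x₂ and sn x₁ have a common sign. Everything thus reduces to the signs of f₁, x₂ and x₁,
and each of these comes from a quotient whose derivative is visibly nonnegative.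

For f₁ the quotient is f₁ / cn, with derivative (sn dn / cn)², so f₁ has at most one root between
consecutive zeros of cn. For x₂ on (0, K) it is x₂ / (cn u) with u = E - (1 - k²) p, whose
derivative is 1 - k² times a square; past K the sign can be read off from two rearrangements of x₂
(`x₂_pos`).

For x₁ = -dn P the Wronskian of P and f₁ is a sum of squares (`x₁Poly_wronskian`), so -P / f₁ is
nondecreasing wherever f₁ ≠ 0. At a positive root of f₁ the product cn P is positive (`mul_x₁Poly`),
which gives x₁ opposite signs at p₁¹ and p₂¹, hence a root between them. On (0, p₁¹) the quotient is
nonnegative, because near 0 it dominates a function tending to 0 (`x₁Poly_div_f₁_ge`). Strict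
positivity and uniqueness follow because P, being analytic in the amplitude, vanishes on no interval
(`exists_x₁Poly_ne_zero`).

Finally f₁(2K) = 2 (2E(k) - K(k)), and 2E - K is strictly decreasing in k with root k₀; this orders
2K and p₁¹. Up to the smaller of the two J₁ is positive, at the larger it is nonpositive, and the
first root lies between. -/

/-! ### Elliptic integrals and Jacobi's functions: derivatives and shifts by 2K -/

/-- The incomplete elliptic integral of the second kind. -/
def ellEInc (k φ : ℝ) : ℝ := ∫ t in (0 : ℝ)..φ, √(1 - k ^ 2 * Real.sin t ^ 2)

theorem integral_zero_pi_of_symm {g : ℝ → ℝ} (hc : Continuous g)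
    (hs : ∀ t, g (Real.pi - t) = g t) :
    ∫ t in (0 : ℝ)..Real.pi, g t = 2 * ∫ t in (0 : ℝ)..(Real.pi / 2), g t := by
  have h1 : ∫ t in (Real.pi / 2)..Real.pi, g t = ∫ t in (0 : ℝ)..(Real.pi / 2), g t := by
    have h := intervalIntegral.integral_comp_sub_left (a := 0) (b := Real.pi / 2) g Real.pi
    simp only [hs] at h
    rw [h, sub_zero]
    congr 1
    ring
  rw [← intervalIntegral.integral_add_adjacent_intervals (hc.intervalIntegrable 0 (Real.pi / 2))
    (hc.intervalIntegrable _ _), h1]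
  ring

theorem integral_zero_add_pi {g : ℝ → ℝ} (hc : Continuous g)
    (hp : Function.Periodic g Real.pi) (φ : ℝ) :
    ∫ t in (0 : ℝ)..(φ + Real.pi), g t =
      (∫ t in (0 : ℝ)..φ, g t) + ∫ t in (0 : ℝ)..Real.pi, g t := by
  rw [← intervalIntegral.integral_add_adjacent_intervals (hc.intervalIntegrable 0 φ)
    (hc.intervalIntegrable _ _), hp.intervalIntegral_add_eq φ 0, zero_add]

variable {k : ℝ}

theorem ellF_zero (k : ℝ) : ellF k 0 = 0 := by simp [ellF]

theorem ellF_strictMono (hk : k ∈ Ico (0 : ℝ) 1) : StrictMono (ellF k) := fun a b hab => by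
  linarith [sub_le_ellF_sub hk hab.le]

theorem hasDerivAt_ellF (hk : k ∈ Ico (0 : ℝ) 1) (φ : ℝ) :
    HasDerivAt (ellF k) (1 / √(1 - k ^ 2 * Real.sin φ ^ 2)) φ :=
  intervalIntegral.integral_hasDerivAt_right ((continuous_integrand hk).intervalIntegrable _ _)
    (continuous_integrand hk).stronglyMeasurable.stronglyMeasurableAtFilter
    (continuous_integrand hk).continuousAt

theorem ellF_add_pi (hk : k ∈ Ico (0 : ℝ) 1) (φ : ℝ) :
    ellF k (φ + Real.pi) = ellF k φ + 2 * ellK k := by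
  unfold ellK ellF
  rw [integral_zero_add_pi (continuous_integrand hk) (fun t => by simp [Real.sin_add_pi]),
    integral_zero_pi_of_symm (continuous_integrand hk) (fun t => by simp [Real.sin_pi_sub])]

theorem continuous_sqrt_integrand (k : ℝ) :
    Continuous fun t : ℝ => √(1 - k ^ 2 * Real.sin t ^ 2) := by fun_prop

theorem hasDerivAt_ellEInc (k φ : ℝ) :
    HasDerivAt (ellEInc k) (√(1 - k ^ 2 * Real.sin φ ^ 2)) φ :=
  intervalIntegral.integral_hasDerivAt_right
    ((continuous_sqrt_integrand k).intervalIntegrable _ _)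
    (continuous_sqrt_integrand k).stronglyMeasurable.stronglyMeasurableAtFilter
    (continuous_sqrt_integrand k).continuousAt

theorem ellEInc_pi (k : ℝ) : ellEInc k Real.pi = 2 * ellE k :=
  integral_zero_pi_of_symm (continuous_sqrt_integrand k) (fun t => by simp [Real.sin_pi_sub])

theorem am_ellF (hk : k ∈ Ico (0 : ℝ) 1) (φ : ℝ) : am k (ellF k φ) = φ :=
  Function.leftInverse_invFun (ellF_bijective hk).1 φ

theorem am_zero (hk : k ∈ Ico (0 : ℝ) 1) : am k 0 = 0 := by
  simpa [ellF_zero] using am_ellF hk 0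

theorem am_ellK (hk : k ∈ Ico (0 : ℝ) 1) : am k (ellK k) = Real.pi / 2 := am_ellF hk _

theorem am_add_two_ellK (hk : k ∈ Ico (0 : ℝ) 1) (p : ℝ) :
    am k (p + 2 * ellK k) = am k p + Real.pi := by
  have := am_ellF hk (am k p + Real.pi)
  rwa [ellF_add_pi hk, ellF_am hk] at this

theorem am_strictMono (hk : k ∈ Ico (0 : ℝ) 1) : StrictMono (am k) := fun a b hab => by
  rwa [← (ellF_strictMono hk).lt_iff_lt, ellF_am hk, ellF_am hk]

theorem continuous_am (hk : k ∈ Ico (0 : ℝ) 1) : Continuous (am k) :=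
  (am_strictMono hk).monotone.continuous_of_surjective fun φ => ⟨ellF k φ, am_ellF hk φ⟩

theorem sn_sq_add_cn_sq (k p : ℝ) : sn k p ^ 2 + cn k p ^ 2 = 1 := Real.sin_sq_add_cos_sq _

theorem dn_pos (hk : k ∈ Ico (0 : ℝ) 1) (p : ℝ) : 0 < dn k p :=
  Real.sqrt_pos.2 (one_sub_pos hk _)

theorem dn_sq (hk : k ∈ Ico (0 : ℝ) 1) (p : ℝ) : dn k p ^ 2 = 1 - k ^ 2 * sn k p ^ 2 :=
  Real.sq_sqrt (one_sub_pos hk _).le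

theorem hasDerivAt_am (hk : k ∈ Ico (0 : ℝ) 1) (p : ℝ) : HasDerivAt (am k) (dn k p) p := by
  have h := (hasDerivAt_ellF hk (am k p)).of_local_left_inverse
    (continuous_am hk).continuousAt (one_div_pos.2 (dn_pos hk p)).ne'
    (Filter.Eventually.of_forall (ellF_am hk))
  simpa [dn, sn] using h

theorem hasDerivAt_sn (hk : k ∈ Ico (0 : ℝ) 1) (p : ℝ) :
    HasDerivAt (sn k) (cn k p * dn k p) p := (hasDerivAt_am hk p).sin

theorem hasDerivAt_cn (hk : k ∈ Ico (0 : ℝ) 1) (p : ℝ) :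
    HasDerivAt (cn k) (-sn k p * dn k p) p := (hasDerivAt_am hk p).cos

theorem hasDerivAt_dn (hk : k ∈ Ico (0 : ℝ) 1) (p : ℝ) :
    HasDerivAt (dn k) (-k ^ 2 * sn k p * cn k p) p := by
  have h := (((hasDerivAt_sn hk p).pow 2).const_mul (k ^ 2)).const_sub 1
  have h2 := h.sqrt (one_sub_pos hk (am k p)).ne'
  refine h2.congr_deriv ?_
  have hd := dn_pos hk p
  change _ / (2 * dn k p) = _
  field_simp
  simp
  ring

theorem continuous_dn (hk : k ∈ Ico (0 : ℝ) 1) : Continuous (dn k) :=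
  continuous_iff_continuousAt.2 fun p => (hasDerivAt_dn hk p).continuousAt

theorem hasDerivAt_jacobiE (hk : k ∈ Ico (0 : ℝ) 1) (p : ℝ) :
    HasDerivAt (jacobiE k) (dn k p ^ 2) p :=
  intervalIntegral.integral_hasDerivAt_right
    (((continuous_dn hk).pow 2).intervalIntegrable _ _)
    ((continuous_dn hk).pow 2).stronglyMeasurable.stronglyMeasurableAtFilter
    ((continuous_dn hk).pow 2).continuousAt

theorem jacobiE_zero (k : ℝ) : jacobiE k 0 = 0 := by simp [jacobiE]

/-- Both sides vanish at 0 and have derivative dn². Passing to the amplitude yields the value of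
`jacobiE` at 2K, and later its analyticity. -/
theorem jacobiE_eq_ellEInc (hk : k ∈ Ico (0 : ℝ) 1) (p : ℝ) :
    jacobiE k p = ellEInc k (am k p) := by
  have h : ∀ x, HasDerivAt (fun x => jacobiE k x - ellEInc k (am k x)) 0 x := fun x => by
    refine ((hasDerivAt_jacobiE hk x).sub
      ((hasDerivAt_ellEInc k _).comp x (hasDerivAt_am hk x))).congr_deriv ?_
    change dn k x ^ 2 - dn k x * dn k x = 0
    ring
  have := is_const_of_deriv_eq_zero (fun x => (h x).differentiableAt) (fun x => (h x).deriv) p 0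
  simp only [jacobiE_zero, am_zero hk, ellEInc, intervalIntegral.integral_same] at this
  simpa [ellEInc] using sub_eq_zero.1 (this.trans (sub_zero 0))

theorem ellK_pos (hk : k ∈ Ico (0 : ℝ) 1) : 0 < ellK k := by
  have := ellF_strictMono hk (show (0 : ℝ) < Real.pi / 2 by positivity)
  rwa [ellF_zero] at this

theorem am_two_ellK (hk : k ∈ Ico (0 : ℝ) 1) : am k (2 * ellK k) = Real.pi := by
  simpa [am_zero hk] using am_add_two_ellK hk 0

theorem sn_add_two_ellK (hk : k ∈ Ico (0 : ℝ) 1) (p : ℝ) : sn k (p + 2 * ellK k) = -sn k p := by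
  simp [sn, am_add_two_ellK hk, Real.sin_add_pi]

theorem cn_add_two_ellK (hk : k ∈ Ico (0 : ℝ) 1) (p : ℝ) : cn k (p + 2 * ellK k) = -cn k p := by
  simp [cn, am_add_two_ellK hk, Real.cos_add_pi]

theorem sn_zero (hk : k ∈ Ico (0 : ℝ) 1) : sn k 0 = 0 := by simp [sn, am_zero hk]

theorem cn_zero (hk : k ∈ Ico (0 : ℝ) 1) : cn k 0 = 1 := by simp [cn, am_zero hk]

theorem sn_ellK (hk : k ∈ Ico (0 : ℝ) 1) : sn k (ellK k) = 1 := by simp [sn, am_ellK hk]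

theorem cn_ellK (hk : k ∈ Ico (0 : ℝ) 1) : cn k (ellK k) = 0 := by simp [cn, am_ellK hk]

theorem sn_two_ellK (hk : k ∈ Ico (0 : ℝ) 1) : sn k (2 * ellK k) = 0 := by
  simp [sn, am_two_ellK hk]

theorem cn_two_ellK (hk : k ∈ Ico (0 : ℝ) 1) : cn k (2 * ellK k) = -1 := by
  simp [cn, am_two_ellK hk]

theorem jacobiE_two_ellK (hk : k ∈ Ico (0 : ℝ) 1) : jacobiE k (2 * ellK k) = 2 * ellE k := by
  rw [jacobiE_eq_ellEInc hk, am_two_ellK hk, ellEInc_pi]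

/-! ### Signs of sn and cn, bounds for E(p) -/

theorem sn_pos (hk : k ∈ Ico (0 : ℝ) 1) {p : ℝ} (h0 : 0 < p) (h2 : p < 2 * ellK k) :
    0 < sn k p := by
  refine Real.sin_pos_of_pos_of_lt_pi ?_ ?_
  · simpa [am_zero hk] using am_strictMono hk h0
  · simpa [am_two_ellK hk] using am_strictMono hk h2

theorem sn_neg (hk : k ∈ Ico (0 : ℝ) 1) {p : ℝ} (h0 : 2 * ellK k < p) (h2 : p < 4 * ellK k) :
    sn k p < 0 := by
  have h := sn_pos hk (p := p - 2 * ellK k) (by linarith) (by linarith)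
  have h' := sn_add_two_ellK hk (p - 2 * ellK k)
  rw [sub_add_cancel] at h'
  linarith

theorem cn_pos (hk : k ∈ Ico (0 : ℝ) 1) {p : ℝ} (h0 : -ellK k < p) (h2 : p < ellK k) :
    0 < cn k p := by
  refine Real.cos_pos_of_mem_Ioo ⟨?_, ?_⟩
  · have h := am_strictMono hk (show ellK k < p + 2 * ellK k by linarith)
    rw [am_ellK hk, am_add_two_ellK hk] at h
    linarith
  · simpa [am_ellK hk] using am_strictMono hk h2

theorem cn_neg (hk : k ∈ Ico (0 : ℝ) 1) {p : ℝ} (h0 : ellK k < p) (h2 : p < 3 * ellK k) :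
    cn k p < 0 := by
  have h := cn_pos hk (p := p - 2 * ellK k) (by linarith) (by linarith)
  have h' := cn_add_two_ellK hk (p - 2 * ellK k)
  rw [sub_add_cancel] at h'
  linarith

theorem cn_pos' (hk : k ∈ Ico (0 : ℝ) 1) {p : ℝ} (h0 : 3 * ellK k < p) (h2 : p < 5 * ellK k) :
    0 < cn k p := by
  have h := cn_neg hk (p := p - 2 * ellK k) (by linarith) (by linarith)
  have h' := cn_add_two_ellK hk (p - 2 * ellK k)
  rw [sub_add_cancel] at h'
  linarith

theorem jacobiE_strictMono (hk : k ∈ Ico (0 : ℝ) 1) : StrictMono (jacobiE k) :=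
  strictMono_of_hasDerivAt_pos (hasDerivAt_jacobiE hk) fun p => pow_pos (dn_pos hk p) 2

theorem jacobiE_pos (hk : k ∈ Ico (0 : ℝ) 1) {p : ℝ} (hp : 0 < p) : 0 < jacobiE k p := by
  simpa [jacobiE_zero] using jacobiE_strictMono hk hp

/-- A function with nonnegative derivative on the line, positive derivative on `(0, b)` and
vanishing at `0`, is positive on the positive half-line. -/
theorem pos_of_deriv_nonneg {g g' : ℝ → ℝ} {b p : ℝ} (hb : 0 < b)
    (hg : ∀ x, HasDerivAt g (g' x) x) (h0 : g 0 = 0) (hn : ∀ x, 0 ≤ g' x)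
    (hpos : ∀ x ∈ Ioo 0 b, 0 < g' x) (hp : 0 < p) : 0 < g p := by
  have hm : Monotone g := monotone_of_deriv_nonneg (fun x => (hg x).differentiableAt)
    fun x => by rw [(hg x).deriv]; exact hn x
  have hs : StrictMonoOn g (Icc 0 b) := by
    refine strictMonoOn_of_deriv_pos (convex_Icc 0 b)
      (fun x _ => (hg x).continuousAt.continuousWithinAt) fun x hx => ?_
    rw [interior_Icc] at hx
    rw [(hg x).deriv]
    exact hpos x hx
  have hmin : 0 < min p b := lt_min hp hb
  have := hs ⟨le_rfl, hb.le⟩ ⟨hmin.le, min_le_right _ _⟩ hmin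
  rw [h0] at this
  exact this.trans_le (hm (min_le_left _ _))

theorem jacobiE_lt (hk : k ∈ Ioo (0 : ℝ) 1) {p : ℝ} (hp : 0 < p) : jacobiE k p < p := by
  have hk' : k ∈ Ico (0 : ℝ) 1 := ⟨hk.1.le, hk.2⟩
  refine sub_pos.1 (pos_of_deriv_nonneg (g := fun x => x - jacobiE k x)
    (g' := fun x => k ^ 2 * sn k x ^ 2) (b := 2 * ellK k) (by linarith [ellK_pos hk'])
    (fun x => ((hasDerivAt_id x).sub (hasDerivAt_jacobiE hk' x)).congr_deriv ?_)
    (by simp [jacobiE_zero]) (fun x => by positivity) (fun x hx => ?_) hp)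
  · rw [dn_sq hk']; ring
  · have := sn_pos hk' hx.1 hx.2
    have := hk.1
    positivity

theorem mul_lt_jacobiE (hk : k ∈ Ioo (0 : ℝ) 1) {p : ℝ} (hp : 0 < p) :
    (1 - k ^ 2) * p < jacobiE k p := by
  have hk' : k ∈ Ico (0 : ℝ) 1 := ⟨hk.1.le, hk.2⟩
  refine sub_pos.1 (pos_of_deriv_nonneg (g := fun x => jacobiE k x - (1 - k ^ 2) * x)
    (g' := fun x => k ^ 2 * cn k x ^ 2) (b := ellK k) (ellK_pos hk')
    (fun x => ((hasDerivAt_jacobiE hk' x).sub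
      ((hasDerivAt_id x).const_mul (1 - k ^ 2))).congr_deriv ?_)
    (by simp [jacobiE_zero]) (fun x => by positivity) (fun x hx => ?_) hp)
  · rw [dn_sq hk']; linear_combination (-k ^ 2) * sn_sq_add_cn_sq k x
  · have := cn_pos hk' (by linarith [ellK_pos hk', hx.1]) hx.2
    have := hk.1
    positivity

/-! ### Roots and sign of f₁ -/

/-- A monotone function that does not grow is constant. This replaces strict monotonicity for f₁ /
cn, whose derivative has zeros where sn does. -/
theorem deriv_eq_zero_of_eq_endpoints {g g' : ℝ → ℝ} {a b : ℝ}
    (hg : ∀ x ∈ Icc a b, HasDerivAt g (g' x) x) (hn : ∀ x ∈ Icc a b, 0 ≤ g' x)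
    (hab : g b ≤ g a) : ∀ x ∈ Ioo a b, g' x = 0 := by
  intro x hx
  have hm : MonotoneOn g (Icc a b) :=
    monotoneOn_of_deriv_nonneg (convex_Icc a b)
      (fun y hy => (hg y hy).continuousAt.continuousWithinAt)
      (fun y hy => (hg y (interior_subset hy)).differentiableAt.differentiableWithinAt)
      (fun y hy => by
        rw [(hg y (interior_subset hy)).deriv]; exact hn y (interior_subset hy))
  have hle : a ≤ b := (hx.1.trans hx.2).le
  have hc : ∀ y ∈ Icc a b, g y = g a := fun y hy =>
    le_antisymm ((hm hy (right_mem_Icc.2 hle) hy.2).trans hab)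
      (hm (left_mem_Icc.2 hle) hy hy.1)
  have h1 : HasDerivAt g 0 x := by
    refine (hasDerivAt_const x (g a)).congr_of_eventuallyEq ?_
    filter_upwards [Ioo_mem_nhds hx.1 hx.2] with y hy
    exact hc y (Ioo_subset_Icc_self hy)
  exact (hg x (Ioo_subset_Icc_self hx)).unique h1

theorem exists_sn_ne_zero (hk : k ∈ Ico (0 : ℝ) 1) {a b : ℝ} (hab : a < b) :
    ∃ x ∈ Ioo a b, sn k x ≠ 0 := by
  by_contra! h
  obtain ⟨x, hx⟩ := nonempty_Ioo.2 hab
  have h1 : HasDerivAt (sn k) 0 x := by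
    refine (hasDerivAt_const x 0).congr_of_eventuallyEq ?_
    filter_upwards [Ioo_mem_nhds hx.1 hx.2] with y hy
    exact h y hy
  have h2 := (hasDerivAt_sn hk x).unique h1
  have h3 := (mul_eq_zero.1 h2).resolve_right (dn_pos hk x).ne'
  simpa [h x hx, h3] using sn_sq_add_cn_sq k x

theorem hasDerivAt_f₁ (hk : k ∈ Ico (0 : ℝ) 1) (p : ℝ) :
    HasDerivAt (f₁ k) (sn k p * dn k p * (2 * jacobiE k p - p)) p := by
  refine (((hasDerivAt_sn hk p).mul (hasDerivAt_dn hk p)).sub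
    ((((hasDerivAt_jacobiE hk p).const_mul 2).sub (hasDerivAt_id p)).mul
      (hasDerivAt_cn hk p))).congr_deriv ?_
  simp only [id, Pi.sub_apply]
  linear_combination (-cn k p) * dn_sq hk p

/-- The quotient is sn dn / cn - (2E - p); in the numerator of the quotient rule the terms with 2E -
p cancel and a square remains. -/
theorem hasDerivAt_f₁_div_cn (hk : k ∈ Ico (0 : ℝ) 1) {p : ℝ} (hc : cn k p ≠ 0) :
    HasDerivAt (fun x => f₁ k x / cn k x) (sn k p ^ 2 * dn k p ^ 2 / cn k p ^ 2) p := by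
  refine ((hasDerivAt_f₁ hk p).div (hasDerivAt_cn hk p) hc).congr_deriv ?_
  congr 1
  rw [f₁]
  ring

theorem continuous_f₁ (hk : k ∈ Ico (0 : ℝ) 1) : Continuous (f₁ k) :=
  continuous_iff_continuousAt.2 fun p => (hasDerivAt_f₁ hk p).continuousAt

theorem f₁_zero (hk : k ∈ Ico (0 : ℝ) 1) : f₁ k 0 = 0 := by
  simp [f₁, sn_zero hk, jacobiE_zero]

theorem sn_three_ellK (hk : k ∈ Ico (0 : ℝ) 1) : sn k (3 * ellK k) = -1 := by
  rw [show 3 * ellK k = ellK k + 2 * ellK k by ring, sn_add_two_ellK hk, sn_ellK hk]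

theorem cn_three_ellK (hk : k ∈ Ico (0 : ℝ) 1) : cn k (3 * ellK k) = 0 := by
  rw [show 3 * ellK k = ellK k + 2 * ellK k by ring, cn_add_two_ellK hk, cn_ellK hk, neg_zero]

theorem sn_five_ellK (hk : k ∈ Ico (0 : ℝ) 1) : sn k (5 * ellK k) = 1 := by
  rw [show 5 * ellK k = 3 * ellK k + 2 * ellK k by ring, sn_add_two_ellK hk, sn_three_ellK hk,
    neg_neg]

theorem cn_five_ellK (hk : k ∈ Ico (0 : ℝ) 1) : cn k (5 * ellK k) = 0 := by
  rw [show 5 * ellK k = 3 * ellK k + 2 * ellK k by ring, cn_add_two_ellK hk, cn_three_ellK hk,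
    neg_zero]

theorem f₁_ellK_pos (hk : k ∈ Ico (0 : ℝ) 1) : 0 < f₁ k (ellK k) := by
  simp [f₁, sn_ellK hk, cn_ellK hk, dn_pos hk]

theorem f₁_three_ellK_neg (hk : k ∈ Ico (0 : ℝ) 1) : f₁ k (3 * ellK k) < 0 := by
  simp [f₁, sn_three_ellK hk, cn_three_ellK hk, dn_pos hk]

theorem f₁_five_ellK_pos (hk : k ∈ Ico (0 : ℝ) 1) : 0 < f₁ k (5 * ellK k) := by
  simp [f₁, sn_five_ellK hk, cn_five_ellK hk, dn_pos hk]

theorem f₁_two_ellK (hk : k ∈ Ico (0 : ℝ) 1) :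
    f₁ k (2 * ellK k) = 2 * (2 * ellE k - ellK k) := by
  rw [f₁, sn_two_ellK hk, cn_two_ellK hk, jacobiE_two_ellK hk]
  ring

theorem f₁_root_unique (hk : k ∈ Ico (0 : ℝ) 1) {A B a b : ℝ}
    (hc : ∀ x ∈ Ioo A B, cn k x ≠ 0) (ha : a ∈ Ioo A B) (hb : b ∈ Ioo A B)
    (fa : f₁ k a = 0) (fb : f₁ k b = 0) : a = b := by
  wlog hab : a < b generalizing a b
  · rcases lt_trichotomy a b with h | h | h
    · exact absurd h hab
    · exact h
    · exact (this hb ha fb fa h).symm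
  exfalso
  have hs : Icc a b ⊆ Ioo A B := fun x hx => ⟨ha.1.trans_le hx.1, hx.2.trans_lt hb.2⟩
  have h := deriv_eq_zero_of_eq_endpoints
    (fun x hx => hasDerivAt_f₁_div_cn hk (hc x (hs hx))) (fun x _ => by positivity)
    (by simp [fa, fb])
  obtain ⟨x, hx, hx0⟩ := exists_sn_ne_zero hk hab
  have := h x hx
  have hcx := hc x (hs (Ioo_subset_Icc_self hx))
  have hd := (dn_pos hk x).ne'
  rw [div_eq_zero_iff] at this
  rcases this with h | h
  · exact mul_ne_zero (pow_ne_zero 2 hx0) (pow_ne_zero 2 hd) h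
  · exact pow_ne_zero 2 hcx h

theorem mem_rootsF₁_one (k p : ℝ) :
    p ∈ rootsF₁ k 1 ↔ p ∈ Ioo (ellK k) (3 * ellK k) ∧ f₁ k p = 0 := by
  simp only [rootsF₁, mem_ofPred_eq, Nat.cast_one]
  rw [show -ellK k + 2 * ellK k * 1 = ellK k by ring,
    show ellK k + 2 * ellK k * 1 = 3 * ellK k by ring]

theorem mem_rootsF₁_two (k p : ℝ) :
    p ∈ rootsF₁ k 2 ↔ p ∈ Ioo (3 * ellK k) (5 * ellK k) ∧ f₁ k p = 0 := by
  simp only [rootsF₁, mem_ofPred_eq, Nat.cast_ofNat]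
  rw [show -ellK k + 2 * ellK k * 2 = 3 * ellK k by ring,
    show ellK k + 2 * ellK k * 2 = 5 * ellK k by ring]

theorem rootsF₁_one_eq (hk : k ∈ Ico (0 : ℝ) 1) : rootsF₁ k 1 = {pF₁ k 1} := by
  have hK := ellK_pos hk
  obtain ⟨r, hr, hr0⟩ := intermediate_value_Ioo' (by linarith : ellK k ≤ 3 * ellK k)
    (continuous_f₁ hk).continuousOn ⟨f₁_three_ellK_neg hk, f₁_ellK_pos hk⟩
  have : rootsF₁ k 1 = {r} := by
    ext x
    rw [mem_rootsF₁_one, mem_singleton_iff]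
    refine ⟨fun h => ?_, fun h => h ▸ ⟨hr, hr0⟩⟩
    exact f₁_root_unique hk (fun y hy => (cn_neg hk hy.1 hy.2).ne) h.1 hr h.2 hr0
  rw [pF₁, this, csInf_singleton]

theorem rootsF₁_two_eq (hk : k ∈ Ico (0 : ℝ) 1) : rootsF₁ k 2 = {pF₁ k 2} := by
  have hK := ellK_pos hk
  obtain ⟨r, hr, hr0⟩ := intermediate_value_Ioo (by linarith : 3 * ellK k ≤ 5 * ellK k)
    (continuous_f₁ hk).continuousOn ⟨f₁_three_ellK_neg hk, f₁_five_ellK_pos hk⟩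
  have : rootsF₁ k 2 = {r} := by
    ext x
    rw [mem_rootsF₁_two, mem_singleton_iff]
    refine ⟨fun h => ?_, fun h => h ▸ ⟨hr, hr0⟩⟩
    exact f₁_root_unique hk (fun y hy => (cn_pos' hk hy.1 hy.2).ne') h.1 hr h.2 hr0
  rw [pF₁, this, csInf_singleton]

theorem pF₁_one_mem (hk : k ∈ Ico (0 : ℝ) 1) : pF₁ k 1 ∈ Ioo (ellK k) (3 * ellK k) :=
  ((mem_rootsF₁_one k _).1 (rootsF₁_one_eq hk ▸ mem_singleton _)).1

theorem f₁_pF₁_one (hk : k ∈ Ico (0 : ℝ) 1) : f₁ k (pF₁ k 1) = 0 :=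
  ((mem_rootsF₁_one k _).1 (rootsF₁_one_eq hk ▸ mem_singleton _)).2

theorem pF₁_two_mem (hk : k ∈ Ico (0 : ℝ) 1) : pF₁ k 2 ∈ Ioo (3 * ellK k) (5 * ellK k) :=
  ((mem_rootsF₁_two k _).1 (rootsF₁_two_eq hk ▸ mem_singleton _)).1

theorem f₁_pF₁_two (hk : k ∈ Ico (0 : ℝ) 1) : f₁ k (pF₁ k 2) = 0 :=
  ((mem_rootsF₁_two k _).1 (rootsF₁_two_eq hk ▸ mem_singleton _)).2

theorem eq_pF₁_one (hk : k ∈ Ico (0 : ℝ) 1) {p : ℝ} (hp : p ∈ Ioo (ellK k) (3 * ellK k))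
    (h : f₁ k p = 0) : p = pF₁ k 1 := by
  have : p ∈ rootsF₁ k 1 := (mem_rootsF₁_one k p).2 ⟨hp, h⟩
  rwa [rootsF₁_one_eq hk] at this

theorem eq_pF₁_two (hk : k ∈ Ico (0 : ℝ) 1) {p : ℝ} (hp : p ∈ Ioo (3 * ellK k) (5 * ellK k))
    (h : f₁ k p = 0) : p = pF₁ k 2 := by
  have : p ∈ rootsF₁ k 2 := (mem_rootsF₁_two k p).2 ⟨hp, h⟩
  rwa [rootsF₁_two_eq hk] at this

theorem f₁_pos_of_lt_ellK (hk : k ∈ Ico (0 : ℝ) 1) {p : ℝ} (h0 : 0 < p) (h1 : p < ellK k) :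
    0 < f₁ k p := by
  have hc : ∀ x ∈ Icc 0 p, 0 < cn k x := fun x hx =>
    cn_pos hk (by linarith [hx.1]) (hx.2.trans_lt h1)
  have hs : StrictMonoOn (fun x => f₁ k x / cn k x) (Icc 0 p) := by
    refine strictMonoOn_of_deriv_pos (convex_Icc 0 p) (fun x hx =>
      (hasDerivAt_f₁_div_cn hk (hc x hx).ne').continuousAt.continuousWithinAt) fun x hx => ?_
    rw [(hasDerivAt_f₁_div_cn hk (hc x (interior_subset hx)).ne').deriv]
    rw [interior_Icc] at hx
    have h2 := sn_pos hk hx.1 (by linarith [hx.2, ellK_pos hk])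
    have h3 := dn_pos hk x
    have h4 := hc x (Ioo_subset_Icc_self hx)
    positivity
  have := hs ⟨le_rfl, h0.le⟩ ⟨h0.le, le_rfl⟩ h0
  simp only [f₁_zero hk, zero_div] at this
  exact (div_pos_iff_of_pos_right (hc p ⟨h0.le, le_rfl⟩)).1 this

theorem f₁_pos (hk : k ∈ Ico (0 : ℝ) 1) {p : ℝ} (h0 : 0 < p) (h1 : p < pF₁ k 1) :
    0 < f₁ k p := by
  rcases lt_or_ge p (ellK k) with h | h
  · exact f₁_pos_of_lt_ellK hk h0 h
  by_contra! hn
  obtain ⟨y, hy, hy0⟩ := intermediate_value_Icc' h (continuous_f₁ hk).continuousOn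
    ⟨hn, (f₁_ellK_pos hk).le⟩
  have hm := pF₁_one_mem hk
  have hyK : y ≠ ellK k := fun h => by
    have := f₁_ellK_pos hk
    rw [← h, hy0] at this
    exact lt_irrefl _ this
  have := eq_pF₁_one hk ⟨lt_of_le_of_ne hy.1 hyK.symm, by linarith [hy.2, hm.2]⟩ hy0
  linarith [hy.2]

theorem f₁_neg (hk : k ∈ Ico (0 : ℝ) 1) {p : ℝ} (h0 : pF₁ k 1 < p) (h1 : p < pF₁ k 2) :
    f₁ k p < 0 := by
  have hm1 := pF₁_one_mem hk
  have hm2 := pF₁_two_mem hk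
  by_contra! hn
  have h3K : ∀ y, f₁ k y = 0 → y ≠ 3 * ellK k := fun y hy h => by
    have := f₁_three_ellK_neg hk
    rw [← h, hy] at this
    exact lt_irrefl _ this
  rcases le_total p (3 * ellK k) with h | h
  · obtain ⟨y, hy, hy0⟩ := intermediate_value_Icc' h (continuous_f₁ hk).continuousOn
      ⟨(f₁_three_ellK_neg hk).le, hn⟩
    have := eq_pF₁_one hk ⟨by linarith [hy.1, hm1.1], lt_of_le_of_ne hy.2 (h3K y hy0)⟩ hy0
    linarith [hy.1]
  · obtain ⟨y, hy, hy0⟩ := intermediate_value_Icc h (continuous_f₁ hk).continuousOn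
      ⟨(f₁_three_ellK_neg hk).le, hn⟩
    have := eq_pF₁_two hk ⟨lt_of_le_of_ne hy.1 (h3K y hy0).symm, by linarith [hy.2, hm2.2]⟩ hy0
    linarith [hy.2]

/-! ### Positivity of x₂ -/

theorem x₂_eq (k p : ℝ) : x₂ k p = sn k p * dn k p * (jacobiE k p - (1 - k ^ 2) * p)
    - cn k p * ((jacobiE k p - (1 - k ^ 2) * p) ^ 2 + k ^ 2 * (1 - k ^ 2) * p ^ 2) := by
  rw [x₂]
  ring

/-- Meant for 2K < p ≤ p₁¹, where the sign of sn spoils `x₂_eq`: there f₁ ≥ 0, cn < 0 and E < p make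
the first term nonnegative and the second positive. -/
theorem x₂_eq_f₁_mul_add (k p : ℝ) : x₂ k p = f₁ k p * (jacobiE k p - (1 - k ^ 2) * p)
    + cn k p * (jacobiE k p * (jacobiE k p - p)) := by
  rw [x₂, f₁]
  ring

theorem continuous_sn (hk : k ∈ Ico (0 : ℝ) 1) : Continuous (sn k) :=
  continuous_iff_continuousAt.2 fun p => (hasDerivAt_sn hk p).continuousAt

theorem continuous_cn (hk : k ∈ Ico (0 : ℝ) 1) : Continuous (cn k) :=
  continuous_iff_continuousAt.2 fun p => (hasDerivAt_cn hk p).continuousAt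

theorem continuous_jacobiE (hk : k ∈ Ico (0 : ℝ) 1) : Continuous (jacobiE k) :=
  continuous_iff_continuousAt.2 fun p => (hasDerivAt_jacobiE hk p).continuousAt

theorem continuous_x₂ (hk : k ∈ Ico (0 : ℝ) 1) : Continuous (x₂ k) := by
  have h1 := continuous_sn hk
  have h2 := continuous_cn hk
  have h3 := continuous_dn hk
  have h4 := continuous_jacobiE hk
  unfold x₂
  fun_prop

theorem hasDerivAt_jacobiE_sub (hk : k ∈ Ico (0 : ℝ) 1) (p : ℝ) :
    HasDerivAt (fun x => jacobiE k x - (1 - k ^ 2) * x) (k ^ 2 * cn k p ^ 2) p := by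
  refine ((hasDerivAt_jacobiE hk p).sub
    ((hasDerivAt_id p).const_mul (1 - k ^ 2))).congr_deriv ?_
  rw [dn_sq hk]
  linear_combination (-k ^ 2) * sn_sq_add_cn_sq k p

/-- The right side is the integral of k² cn² over (0, p), and cn² decreases on (0, K), so the
integral exceeds p times the value at the right end. -/
theorem sq_cn_mul_lt (hk : k ∈ Ioo (0 : ℝ) 1) {p : ℝ} (h0 : 0 < p) (h1 : p < ellK k) :
    k ^ 2 * cn k p ^ 2 * p < jacobiE k p - (1 - k ^ 2) * p := by
  have hk' : k ∈ Ico (0 : ℝ) 1 := ⟨hk.1.le, hk.2⟩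
  have hg : ∀ x, HasDerivAt (fun x => jacobiE k x - (1 - k ^ 2) * x - k ^ 2 * cn k x ^ 2 * x)
      (2 * k ^ 2 * cn k x * sn k x * dn k x * x) x := fun x => by
    refine ((hasDerivAt_jacobiE_sub hk' x).sub
      ((((hasDerivAt_cn hk' x).pow 2).const_mul (k ^ 2)).mul (hasDerivAt_id x))).congr_deriv ?_
    simp only [id, Pi.pow_apply]
    push_cast
    ring
  have hs : StrictMonoOn (fun x => jacobiE k x - (1 - k ^ 2) * x - k ^ 2 * cn k x ^ 2 * x)
      (Icc 0 p) := by
    refine strictMonoOn_of_deriv_pos (convex_Icc 0 p)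
      (fun x _ => (hg x).continuousAt.continuousWithinAt) fun x hx => ?_
    rw [(hg x).deriv]
    rw [interior_Icc] at hx
    have h2 := sn_pos hk' hx.1 (by linarith [hx.2, ellK_pos hk'])
    have h3 := dn_pos hk' x
    have h4 := cn_pos hk' (by linarith [hx.1, ellK_pos hk']) (hx.2.trans h1)
    have := hx.1
    have := hk.1
    positivity
  have := hs ⟨le_rfl, h0.le⟩ ⟨h0.le, le_rfl⟩ h0
  simp [jacobiE_zero] at this
  linarith

/-- The function is x₂ / (cn u) with u = E - (1 - k²) p, as `x₂_eq` shows. -/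
theorem hasDerivAt_x₂_div (hk : k ∈ Ico (0 : ℝ) 1) {p : ℝ} (hc : cn k p ≠ 0)
    (hu : jacobiE k p - (1 - k ^ 2) * p ≠ 0) :
    HasDerivAt (fun x => sn k x * dn k x / cn k x - (jacobiE k x - (1 - k ^ 2) * x)
        - k ^ 2 * (1 - k ^ 2) * x ^ 2 / (jacobiE k x - (1 - k ^ 2) * x))
      ((1 - k ^ 2) *
        (k ^ 2 * cn k p * p / (jacobiE k p - (1 - k ^ 2) * p) - 1 / cn k p) ^ 2) p := by
  have hu' := hasDerivAt_jacobiE_sub hk p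
  refine (((((hasDerivAt_sn hk p).mul (hasDerivAt_dn hk p)).div (hasDerivAt_cn hk p) hc).sub
    hu').sub ((((hasDerivAt_id p).pow 2).const_mul (k ^ 2 * (1 - k ^ 2))).div hu' hu)).congr_deriv
    ?_
  simp only [id, Pi.mul_apply, Pi.pow_apply]
  generalize jacobiE k p - (1 - k ^ 2) * p = u at *
  have h1 := dn_sq hk p
  have h2 := sn_sq_add_cn_sq k p
  generalize sn k p = s at *
  generalize cn k p = c at *
  generalize dn k p = d at *
  -- The summand k² c² cancels against the derivative of u; what is left is 1 - k² times a completed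
  -- square.
  have h3 : ((c * d * d + s * (-k ^ 2 * s * c)) * c - s * d * (-s * d)) / c ^ 2
      = (1 - k ^ 2) / c ^ 2 + k ^ 2 * c ^ 2 := by
    field_simp
    have h2' : s ^ 2 = 1 - c ^ 2 := by linarith
    rw [h2'] at h1
    ring_nf
    simp only [h2', h1]
    ring
  rw [h3]
  field_simp
  push_cast
  ring

theorem x₂_pos_of_lt_ellK (hk : k ∈ Ioo (0 : ℝ) 1) {p : ℝ} (h0 : 0 < p) (h1 : p < ellK k) :
    0 < x₂ k p := by
  have hk' : k ∈ Ico (0 : ℝ) 1 := ⟨hk.1.le, hk.2⟩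
  have hl : 0 < 1 - k ^ 2 := by nlinarith [hk.1, hk.2]
  have hk2 : 0 < k ^ 2 := pow_pos hk.1 2
  have hc : ∀ x ∈ Ioo 0 (ellK k), 0 < cn k x := fun x hx =>
    cn_pos hk' (by linarith [hx.1, ellK_pos hk']) hx.2
  have hu : ∀ x ∈ Ioo 0 (ellK k), 0 < jacobiE k x - (1 - k ^ 2) * x := fun x hx =>
    sub_pos.2 (mul_lt_jacobiE hk hx.1)
  set g : ℝ → ℝ := fun x => sn k x * dn k x / cn k x - (jacobiE k x - (1 - k ^ 2) * x)
        - k ^ 2 * (1 - k ^ 2) * x ^ 2 / (jacobiE k x - (1 - k ^ 2) * x) with hg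
  have hs : StrictMonoOn g (Ioo 0 (ellK k)) := by
    refine strictMonoOn_of_deriv_pos (convex_Ioo 0 _) (fun x hx =>
      (hasDerivAt_x₂_div hk' (hc x hx).ne' (hu x hx).ne').continuousAt.continuousWithinAt)
      fun x hx => ?_
    rw [interior_Ioo] at hx
    rw [(hasDerivAt_x₂_div hk' (hc x hx).ne' (hu x hx).ne').deriv]
    have h2 : k ^ 2 * cn k x * x / (jacobiE k x - (1 - k ^ 2) * x) < 1 / cn k x := by
      rw [div_lt_div_iff₀ (hu x hx) (hc x hx)]
      linarith [sq_cn_mul_lt hk hx.1 hx.2]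
    exact mul_pos hl (sq_pos_of_neg (sub_neg.2 h2))
  have hnn : ∀ y ∈ Ioo 0 (ellK k), 0 ≤ g y := by
    intro y hy
    -- A minorant of g with value 0 at 0. In g only x² / u is of the form 0/0, and `sq_cn_mul_lt`
    -- gives k² x² / u ≤ x / cn².
    have hcont : ContinuousAt (fun x => sn k x * dn k x / cn k x
        - (jacobiE k x - (1 - k ^ 2) * x) - (1 - k ^ 2) * x / cn k x ^ 2) 0 := by
      have h1 := (continuous_sn hk').continuousAt (x := 0)
      have h2 := (continuous_cn hk').continuousAt (x := 0)
      have h3 := (continuous_dn hk').continuousAt (x := 0)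
      have h4 := (continuous_jacobiE hk').continuousAt (x := 0)
      have h5 : cn k 0 ≠ 0 := by simp [cn_zero hk']
      have h6 : cn k 0 ^ 2 ≠ 0 := pow_ne_zero 2 h5
      fun_prop (disch := assumption)
    have ht := hcont.tendsto.mono_left (nhdsWithin_le_nhds (s := Ioi 0))
    simp only [sn_zero hk', jacobiE_zero, zero_mul, mul_zero, zero_div, sub_zero] at ht
    refine le_of_tendsto ht ?_
    filter_upwards [Ioo_mem_nhdsGT hy.1] with x hx
    have hx' : x ∈ Ioo 0 (ellK k) := ⟨hx.1, hx.2.trans hy.2⟩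
    refine le_trans ?_ (hs hx' hy hx.2).le
    refine sub_le_sub_left ?_ _
    have hc' := hc x hx'
    rw [div_le_div_iff₀ (hu x hx') (by positivity)]
    have := sq_cn_mul_lt hk hx'.1 hx'.2
    nlinarith [mul_lt_mul_of_pos_left this (mul_pos hl hx.1)]
  have hp : p ∈ Ioo 0 (ellK k) := ⟨h0, h1⟩
  have hp2 : p / 2 ∈ Ioo 0 (ellK k) := ⟨by linarith, by linarith⟩
  have hgp : 0 < g p := (hnn _ hp2).trans_lt (hs hp2 hp (by linarith))
  have hcp := hc p hp
  have hup := hu p hp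
  have : x₂ k p = g p * (cn k p * (jacobiE k p - (1 - k ^ 2) * p)) := by
    rw [x₂_eq]
    simp only [hg]
    generalize jacobiE k p - (1 - k ^ 2) * p = u at *
    field_simp
    ring
  rw [this]
  positivity

/-- Below K this is the monotone quotient. From K to 2K one has cn ≤ 0 ≤ sn, so both terms of
`x₂_eq` help. Beyond 2K, which matters only if p₁¹ > 2K, `x₂_eq_f₁_mul_add` takes over. -/
theorem x₂_pos (hk : k ∈ Ioo (0 : ℝ) 1) {p : ℝ} (h0 : 0 < p)
    (h1 : p ≤ 2 * ellK k ∨ p ≤ pF₁ k 1) : 0 < x₂ k p := by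
  have hk' : k ∈ Ico (0 : ℝ) 1 := ⟨hk.1.le, hk.2⟩
  have hK := ellK_pos hk'
  have hl : 0 < 1 - k ^ 2 := by nlinarith [hk.1, hk.2]
  have hk2 : 0 < k ^ 2 := pow_pos hk.1 2
  have hu := sub_pos.2 (mul_lt_jacobiE hk h0)
  rcases lt_trichotomy p (ellK k) with hp | hp | hp
  · exact x₂_pos_of_lt_ellK hk h0 hp
  · rw [hp] at hu
    rw [x₂_eq, hp, sn_ellK hk', cn_ellK hk']
    have := dn_pos hk' (ellK k)
    simp only [one_mul, zero_mul, sub_zero]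
    positivity
  · by_cases h2 : p ≤ 2 * ellK k
    · have hc := cn_neg hk' hp (by linarith)
      have hs : 0 ≤ sn k p := by
        rcases h2.lt_or_eq with h | h
        · exact (sn_pos hk' h0 h).le
        · rw [h, sn_two_ellK hk']
      have hd := dn_pos hk' p
      rw [x₂_eq]
      have h3 : 0 < (jacobiE k p - (1 - k ^ 2) * p) ^ 2 + k ^ 2 * (1 - k ^ 2) * p ^ 2 := by
        positivity
      have h4 : 0 ≤ sn k p * dn k p * (jacobiE k p - (1 - k ^ 2) * p) := by positivity
      nlinarith
    · have h3 := h1.resolve_left h2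
      have hm := pF₁_one_mem hk'
      have hc := cn_neg hk' hp (by linarith [hm.2])
      have hf : 0 ≤ f₁ k p := by
        rcases h3.lt_or_eq with h | h
        · exact (f₁_pos hk' h0 h).le
        · rw [h, f₁_pF₁_one hk']
      rw [x₂_eq_f₁_mul_add]
      have h5 := mul_pos_of_neg_of_neg hc
        (mul_neg_of_pos_of_neg (jacobiE_pos hk' h0) (sub_neg.2 (jacobiE_lt hk h0)))
      nlinarith [mul_nonneg hf hu.le]

/-! ### Algebraic identities relating x₁ and f₁ -/

/-- The polynomial expression `-x₁ / dn` in `k`, `sn`, `cn`, `dn`, `E` and `p`. -/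
def x₁Poly (k s c d E p : ℝ) : ℝ :=
  s * d * (2 * E - p) * (E ^ 2 - 2 * (1 - k ^ 2) * p * E + (1 - k ^ 2) * p ^ 2)
    + c * (1 - 2 * k ^ 2 * s ^ 2) * ((2 * E - p) * (E - (1 - k ^ 2) * p)
      + (E ^ 2 - 2 * (1 - k ^ 2) * p * E + (1 - k ^ 2) * p ^ 2))
    - s * d * (1 + 4 * k ^ 2 - 6 * k ^ 2 * s ^ 2) * E
    + p * (s * d) * (1 - k ^ 2 * (5 - 4 * k ^ 2) * s ^ 2) + 2 * k ^ 2 * c * (s * d) ^ 2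

/-- The derivative of `x₁Poly` along the flow of Jacobi's functions. -/
def x₁PolyDeriv (k s c d E p : ℝ) : ℝ :=
  let a := s * d
  let a1 := c * d ^ 2 - k ^ 2 * s ^ 2 * c
  let r := 2 * E - p
  let r1 := 2 * d ^ 2 - 1
  let l := 1 - k ^ 2
  let Q := E ^ 2 - 2 * l * p * E + l * p ^ 2
  let Q1 := 2 * E * d ^ 2 - 2 * l * (E + p * d ^ 2) + 2 * l * p
  let u := E - l * p
  let u1 := d ^ 2 - l
  let n := 1 - 2 * k ^ 2 * s ^ 2
  let m := 1 + 4 * k ^ 2 - 6 * k ^ 2 * s ^ 2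
  let t := 1 - k ^ 2 * (5 - 4 * k ^ 2) * s ^ 2
  a1 * r * Q + a * r1 * Q + a * r * Q1
    + (-(s * d) * n + c * (-4 * k ^ 2 * s * c * d)) * (r * u + Q)
    + c * n * (r1 * u + r * u1 + Q1) - a1 * m * E - a * (-12 * k ^ 2 * s * c * d) * E
    - a * m * d ^ 2 + a * t + p * a1 * t + p * a * (-k ^ 2 * (5 - 4 * k ^ 2) * 2 * s * c * d)
    + 2 * k ^ 2 * (-(s * d) * a ^ 2 + 2 * c * a * a1)

/-- The left side is P f₁' - P' f₁, the numerator of the derivative of -P / f₁. Its form as a sum of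
squares is what makes that quotient monotone. -/
theorem x₁Poly_wronskian {k s c d : ℝ} (E p : ℝ) (h1 : s ^ 2 + c ^ 2 = 1)
    (h2 : d ^ 2 = 1 - k ^ 2 * s ^ 2) :
    x₁Poly k s c d E p * (s * d * (2 * E - p))
        - x₁PolyDeriv k s c d E p * (s * d - (2 * E - p) * c)
      = ((2 * E - p) * (k ^ 2 * c ^ 2 * E - (1 - k ^ 2) * (p - E))
          + k ^ 2 * (s * d) * c * (p - E - 3 * E) + 2 * k ^ 2 * (s * d) ^ 2) ^ 2
        + k ^ 2 * (1 - k ^ 2) * ((2 * E - p) * (E + c ^ 2 * (p - E))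
          + s * d * c * (E - 3 * (p - E)) - 2 * (s * d) ^ 2) ^ 2 := by
  unfold x₁Poly x₁PolyDeriv
  grind

/-- Reduction of cn P modulo f₁. The remainder is a sum of squares, so it fixes the sign of P at the
roots of f₁; the cofactor of f₁ controls -P / f₁ near 0. -/
theorem mul_x₁Poly {k s c d : ℝ} (E p : ℝ) (h1 : s ^ 2 + c ^ 2 = 1)
    (h2 : d ^ 2 = 1 - k ^ 2 * s ^ 2) :
    c * x₁Poly k s c d E p = d ^ 4 * (p - E) ^ 2 + k ^ 2 * (1 - k ^ 2) * s ^ 4 * E ^ 2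
      + (s * d - (2 * E - p) * c) * (2 * k ^ 2 * c ^ 2 * (s * d + c * (2 * E - p))
        + c * (p * (1 - k ^ 2 * (5 - 4 * k ^ 2) * s ^ 2)
          - (1 + 4 * k ^ 2 - 6 * k ^ 2 * s ^ 2) * E)
        - s * d * (E ^ 2 - 2 * (1 - k ^ 2) * p * E + (1 - k ^ 2) * p ^ 2)) := by
  unfold x₁Poly
  grind

theorem x₁_eq (k p : ℝ) :
    x₁ k p = -dn k p * x₁Poly k (sn k p) (cn k p) (dn k p) (jacobiE k p) p := by
  rw [x₁, x₁Poly]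
  ring

theorem hasDerivAt_x₁Poly (hk : k ∈ Ico (0 : ℝ) 1) (p : ℝ) :
    HasDerivAt (fun x => x₁Poly k (sn k x) (cn k x) (dn k x) (jacobiE k x) x)
      (x₁PolyDeriv k (sn k p) (cn k p) (dn k p) (jacobiE k p) p) p := by
  have hs := hasDerivAt_sn hk p
  have hc := hasDerivAt_cn hk p
  have hE := hasDerivAt_jacobiE hk p
  have hp := hasDerivAt_id p
  have ha := hs.mul (hasDerivAt_dn hk p)
  have hr := (hE.const_mul 2).sub hp
  have hu := hE.sub (hp.const_mul (1 - k ^ 2))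
  have hQ := ((hE.pow 2).sub ((hp.const_mul (2 * (1 - k ^ 2))).mul hE)).add
    ((hp.pow 2).const_mul (1 - k ^ 2))
  have hn := ((hs.pow 2).const_mul (2 * k ^ 2)).const_sub 1
  have hm := ((hs.pow 2).const_mul (6 * k ^ 2)).const_sub (1 + 4 * k ^ 2)
  have ht := ((hs.pow 2).const_mul (k ^ 2 * (5 - 4 * k ^ 2))).const_sub 1
  refine ((((((ha.mul hr).mul hQ).add ((hc.mul hn).mul ((hr.mul hu).add hQ))).sub
    ((ha.mul hm).mul hE)).add ((hp.mul ha).mul ht)).add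
    ((hc.const_mul (2 * k ^ 2)).mul (ha.pow 2))).congr_deriv ?_
  simp only [id, Pi.mul_apply, Pi.pow_apply, Pi.sub_apply, Pi.add_apply, x₁PolyDeriv]
  push_cast
  ring

theorem exists_hasDerivAt_x₁Poly_div_f₁ (hk : k ∈ Ico (0 : ℝ) 1) :
    ∃ g' : ℝ → ℝ, (∀ p, 0 ≤ g' p) ∧ ∀ p, f₁ k p ≠ 0 → HasDerivAt
      (fun x => -x₁Poly k (sn k x) (cn k x) (dn k x) (jacobiE k x) x / f₁ k x) (g' p) p := by
  refine ⟨fun p => (x₁Poly k (sn k p) (cn k p) (dn k p) (jacobiE k p) p *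
    (sn k p * dn k p * (2 * jacobiE k p - p)) -
    x₁PolyDeriv k (sn k p) (cn k p) (dn k p) (jacobiE k p) p * f₁ k p) / f₁ k p ^ 2,
    fun p => ?_, fun p hp => ?_⟩
  · unfold f₁
    beta_reduce
    rw [x₁Poly_wronskian _ _ (sn_sq_add_cn_sq k p) (dn_sq hk p)]
    have : 0 ≤ 1 - k ^ 2 := by nlinarith [hk.1, hk.2]
    positivity
  · refine ((hasDerivAt_x₁Poly hk p).neg.div (hasDerivAt_f₁ hk p) hp).congr_deriv ?_
    congr 1
    simp only [Pi.neg_apply]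
    ring

theorem mul_x₁Poly_of_f₁_eq_zero (hk : k ∈ Ico (0 : ℝ) 1) {p : ℝ} (h : f₁ k p = 0) :
    cn k p * x₁Poly k (sn k p) (cn k p) (dn k p) (jacobiE k p) p =
      dn k p ^ 4 * (p - jacobiE k p) ^ 2
        + k ^ 2 * (1 - k ^ 2) * sn k p ^ 4 * jacobiE k p ^ 2 := by
  rw [mul_x₁Poly _ _ (sn_sq_add_cn_sq k p) (dn_sq hk p)]
  rw [f₁] at h
  rw [h]
  ring

theorem mul_x₁Poly_pos_of_f₁_eq_zero (hk : k ∈ Ioo (0 : ℝ) 1) {p : ℝ} (hp : 0 < p)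
    (h : f₁ k p = 0) :
    0 < cn k p * x₁Poly k (sn k p) (cn k p) (dn k p) (jacobiE k p) p := by
  have hk' : k ∈ Ico (0 : ℝ) 1 := ⟨hk.1.le, hk.2⟩
  rw [mul_x₁Poly_of_f₁_eq_zero hk' h]
  have h1 := dn_pos hk' p
  have h2 := sub_pos.2 (jacobiE_lt hk hp)
  have : 0 ≤ 1 - k ^ 2 := by nlinarith [hk.1, hk.2]
  positivity

theorem x₁_pF₁_one_pos (hk : k ∈ Ioo (0 : ℝ) 1) : 0 < x₁ k (pF₁ k 1) := by
  have hk' : k ∈ Ico (0 : ℝ) 1 := ⟨hk.1.le, hk.2⟩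
  have hm := pF₁_one_mem hk'
  have h := mul_x₁Poly_pos_of_f₁_eq_zero hk ((ellK_pos hk').trans hm.1) (f₁_pF₁_one hk')
  rw [x₁_eq]
  have h2 := neg_of_mul_pos_right h (cn_neg hk' hm.1 hm.2).le
  exact mul_pos_of_neg_of_neg (neg_neg_of_pos (dn_pos hk' _)) h2

theorem x₁_pF₁_two_neg (hk : k ∈ Ioo (0 : ℝ) 1) : x₁ k (pF₁ k 2) < 0 := by
  have hk' : k ∈ Ico (0 : ℝ) 1 := ⟨hk.1.le, hk.2⟩
  have hm := pF₁_two_mem hk'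
  have h := mul_x₁Poly_pos_of_f₁_eq_zero hk (by linarith [hm.1, ellK_pos hk']) (f₁_pF₁_two hk')
  rw [x₁_eq]
  exact mul_neg_of_neg_of_pos (neg_neg_of_pos (dn_pos hk' _))
    (pos_of_mul_pos_right h (cn_pos' hk' hm.1 hm.2).le)

theorem continuous_x₁ (hk : k ∈ Ico (0 : ℝ) 1) : Continuous (x₁ k) := by
  have h1 := continuous_sn hk
  have h2 := continuous_cn hk
  have h3 := continuous_dn hk
  have h4 := continuous_jacobiE hk
  unfold x₁
  fun_prop

/-! ### Lower bound for -P / f₁ near 0 -/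

/-- After division by cn both sides vanish at 0, and their derivatives compare because 1 - k² ≤ dn²
/ cn². This bounds p - E by a multiple of f₁ without Taylor expansions. -/
theorem sub_jacobiE_mul_cn_le (hk : k ∈ Ico (0 : ℝ) 1) {p : ℝ} (h0 : 0 ≤ p)
    (h1 : p < ellK k) :
    (1 - k ^ 2) * (p - jacobiE k p) * cn k p ≤ k ^ 2 * f₁ k p := by
  have hc : ∀ x ∈ Icc 0 p, 0 < cn k x := fun x hx =>
    cn_pos hk (by linarith [hx.1, ellK_pos hk]) (hx.2.trans_lt h1)
  have hg : ∀ x ∈ Icc 0 p, HasDerivAt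
      (fun x => k ^ 2 * (f₁ k x / cn k x) - (1 - k ^ 2) * (x - jacobiE k x))
      (k ^ 2 * (sn k x ^ 2 * dn k x ^ 2 / cn k x ^ 2) - (1 - k ^ 2) * (1 - dn k x ^ 2)) x :=
    fun x hx => ((hasDerivAt_f₁_div_cn hk (hc x hx).ne').const_mul _).sub
      (((hasDerivAt_id x).sub (hasDerivAt_jacobiE hk x)).const_mul _)
  have hm : MonotoneOn (fun x => k ^ 2 * (f₁ k x / cn k x) - (1 - k ^ 2) * (x - jacobiE k x))
      (Icc 0 p) := by
    refine monotoneOn_of_deriv_nonneg (convex_Icc 0 p)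
      (fun y hy => (hg y hy).continuousAt.continuousWithinAt)
      (fun y hy => (hg y (interior_subset hy)).differentiableAt.differentiableWithinAt)
      (fun y hy => ?_)
    have hcy := hc y (interior_subset hy)
    rw [(hg y (interior_subset hy)).deriv]
    have h2 := dn_sq hk y
    have h3 := sn_sq_add_cn_sq k y
    have h4 : 1 - k ^ 2 ≤ dn k y ^ 2 / cn k y ^ 2 := by
      rw [le_div_iff₀ (by positivity), h2]
      nlinarith [mul_nonneg (sq_nonneg k) (sq_nonneg (cn k y)), sq_nonneg (sn k y)]
    have h5 : 1 - dn k y ^ 2 = k ^ 2 * sn k y ^ 2 := by rw [h2]; ring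
    rw [h5, mul_div_assoc]
    nlinarith [mul_le_mul_of_nonneg_left h4 (show 0 ≤ k ^ 2 * sn k y ^ 2 by positivity)]
  have := hm ⟨le_rfl, h0⟩ ⟨h0, le_rfl⟩ h0
  simp only [f₁_zero hk, jacobiE_zero, zero_div, mul_zero, sub_zero] at this
  have hcp := hc p ⟨h0, le_rfl⟩
  have h6 := sub_nonneg.1 this
  rw [← mul_div_assoc, le_div_iff₀ hcp] at h6
  exact h6

/-- Both sides vanish at 0, and the derivative of the difference is 3 k² sn² (1 - cn dn) ≥ 0. -/
theorem sn_pow_three_le (hk : k ∈ Ico (0 : ℝ) 1) {p : ℝ} (h0 : 0 ≤ p) :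
    k ^ 2 * sn k p ^ 3 ≤ 3 * (p - jacobiE k p) := by
  have hg : ∀ x, HasDerivAt (fun x => 3 * (x - jacobiE k x) - k ^ 2 * sn k x ^ 3)
      (3 * k ^ 2 * sn k x ^ 2 * (1 - cn k x * dn k x)) x := fun x => by
    refine ((((hasDerivAt_id x).sub (hasDerivAt_jacobiE hk x)).const_mul 3).sub
      (((hasDerivAt_sn hk x).pow 3).const_mul (k ^ 2))).congr_deriv ?_
    rw [dn_sq hk]
    push_cast
    ring
  have hm : Monotone (fun x => 3 * (x - jacobiE k x) - k ^ 2 * sn k x ^ 3) := by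
    refine monotone_of_deriv_nonneg (fun x => (hg x).differentiableAt) fun x => ?_
    rw [(hg x).deriv]
    have h2 := dn_sq hk x
    have h3 := sn_sq_add_cn_sq k x
    have h4 : cn k x * dn k x ≤ 1 := by
      nlinarith [sq_nonneg (cn k x - dn k x), sq_nonneg (sn k x), sq_nonneg (k * sn k x)]
    have := sub_nonneg.2 h4
    positivity
  have := hm h0
  simp only [jacobiE_zero, sn_zero hk] at this
  norm_num at this
  exact this

/-- By `mul_x₁Poly`, cn P = S + f₁ T with S a sum of squares. The two preceding bounds extract from
S a factor p - E and then a factor f₁, so f₁ cancels and the left side is continuous at 0, with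
value 0. -/
theorem x₁Poly_div_f₁_ge (hk : k ∈ Ioo (0 : ℝ) 1) {p : ℝ} (h0 : 0 < p) (h1 : p < ellK k) :
    (-(k ^ 2 * ((p - jacobiE k p) + 3 * (1 - k ^ 2) * sn k p * jacobiE k p ^ 2)
        / ((1 - k ^ 2) * cn k p))
      - (2 * k ^ 2 * cn k p ^ 2 * (sn k p * dn k p + cn k p * (2 * jacobiE k p - p))
        + cn k p * (p * (1 - k ^ 2 * (5 - 4 * k ^ 2) * sn k p ^ 2)
          - (1 + 4 * k ^ 2 - 6 * k ^ 2 * sn k p ^ 2) * jacobiE k p)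
        - sn k p * dn k p * (jacobiE k p ^ 2 - 2 * (1 - k ^ 2) * p * jacobiE k p
          + (1 - k ^ 2) * p ^ 2))) / cn k p
      ≤ -x₁Poly k (sn k p) (cn k p) (dn k p) (jacobiE k p) p / f₁ k p := by
  have hk' : k ∈ Ico (0 : ℝ) 1 := ⟨hk.1.le, hk.2⟩
  have hK := ellK_pos hk'
  have hl : 0 < 1 - k ^ 2 := by nlinarith [hk.1, hk.2]
  have hk2 : 0 < k ^ 2 := pow_pos hk.1 2
  have hc := cn_pos hk' (by linarith : -ellK k < p) h1
  have hs := sn_pos hk' h0 (by linarith : p < 2 * ellK k)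
  have hf := f₁_pos_of_lt_ellK hk' h0 h1
  have hE := jacobiE_pos hk' h0
  have hq := sub_pos.2 (jacobiE_lt hk h0)
  have hd := dn_pos hk' p
  have hd1 : dn k p ^ 2 ≤ 1 := by rw [dn_sq hk']; nlinarith [mul_pos hk2 (pow_pos hs 2)]
  have hd4 : dn k p ^ 4 ≤ 1 := by nlinarith [sq_nonneg (dn k p)]
  have e1 := sub_jacobiE_mul_cn_le hk' h0.le h1
  have e2 := sn_pow_three_le hk' h0.le
  have key := mul_x₁Poly (jacobiE k p) p (sn_sq_add_cn_sq k p) (dn_sq hk' p)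
  rw [← f₁] at key
  generalize x₁Poly k (sn k p) (cn k p) (dn k p) (jacobiE k p) p = P at *
  generalize (2 * k ^ 2 * cn k p ^ 2 * (sn k p * dn k p + cn k p * (2 * jacobiE k p - p))
        + cn k p * (p * (1 - k ^ 2 * (5 - 4 * k ^ 2) * sn k p ^ 2)
          - (1 + 4 * k ^ 2 - 6 * k ^ 2 * sn k p ^ 2) * jacobiE k p)
        - sn k p * dn k p * (jacobiE k p ^ 2 - 2 * (1 - k ^ 2) * p * jacobiE k p
          + (1 - k ^ 2) * p ^ 2)) = T at *
  generalize f₁ k p = f at *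
  generalize jacobiE k p = E at *
  generalize p - E = q at *
  generalize dn k p = d at *
  generalize cn k p = c at *
  generalize sn k p = s at *
  rw [div_le_div_iff₀ hc hf]
  have h2 : d ^ 4 * q ^ 2 + k ^ 2 * (1 - k ^ 2) * s ^ 4 * E ^ 2
      ≤ q * (q + 3 * (1 - k ^ 2) * s * E ^ 2) := by
    nlinarith [mul_le_mul_of_nonneg_right hd4 (sq_nonneg q),
      mul_le_mul_of_nonneg_left e2 (show 0 ≤ (1 - k ^ 2) * s * E ^ 2 by positivity)]
  have h3 : q * (q + 3 * (1 - k ^ 2) * s * E ^ 2)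
      ≤ k ^ 2 * (q + 3 * (1 - k ^ 2) * s * E ^ 2) / ((1 - k ^ 2) * c) * f := by
    rw [div_mul_eq_mul_div, le_div_iff₀ (by positivity)]
    nlinarith [mul_le_mul_of_nonneg_right e1
      (show 0 ≤ q + 3 * (1 - k ^ 2) * s * E ^ 2 by positivity)]
  linarith

/-! ### Analyticity in the amplitude -/

/-- A real primitive of the real part of a holomorphic function is real analytic. -/
theorem analyticAt_of_hasDerivAt_re {F : ℝ → ℝ} {g : ℂ → ℂ} {x₀ : ℝ}
    (hg : AnalyticAt ℂ g x₀) (hF : ∀ x : ℝ, HasDerivAt F (g x).re x) : AnalyticAt ℝ F x₀ := by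
  obtain ⟨r, hr, hd⟩ := Metric.eventually_nhds_iff_ball.1 hg.eventually_analyticAt
  have hdiff : DifferentiableOn ℂ g (Metric.ball (x₀ : ℂ) r) := fun z hz =>
    (hd z hz).differentiableAt.differentiableWithinAt
  obtain ⟨G, hG⟩ := hdiff.isExactOn_ball
  have hmem : ∀ x ∈ Metric.ball x₀ r, (x : ℂ) ∈ Metric.ball (x₀ : ℂ) r := fun x hx => by
    simpa [Complex.dist_eq, ← Complex.ofReal_sub, Real.dist_eq] using hx
  have hGan : AnalyticAt ℂ G x₀ := by
    refine DifferentiableOn.analyticAt (s := Metric.ball (x₀ : ℂ) r)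
      (fun z hz => (hG z hz).differentiableAt.differentiableWithinAt)
      (Metric.ball_mem_nhds _ hr)
  have hsub : ∀ x ∈ Metric.ball x₀ r, HasDerivAt (fun x : ℝ => F x - (G x).re) 0 x :=
    fun x hx => ((hF x).sub (hG x (hmem x hx)).real_of_complex).congr_deriv (sub_self _)
  have hconst : ∀ x ∈ Metric.ball x₀ r, F x - (G x).re = F x₀ - (G x₀).re := fun x hx =>
    Metric.isOpen_ball.is_const_of_deriv_eq_zero (convex_ball x₀ r).isPreconnected
      (fun y hy => (hsub y hy).differentiableAt.differentiableWithinAt)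
      (fun y hy => (hsub y hy).deriv) hx (Metric.mem_ball_self hr)
  refine (hGan.re_ofReal.add (analyticAt_const (v := F x₀ - (G x₀).re))).congr ?_
  filter_upwards [Metric.ball_mem_nhds x₀ hr] with x hx
  simp only [Pi.add_apply]
  linarith [hconst x hx]

/-- Writing powers of 1 - k² sin² as exp (e log) gives a holomorphic extension near the real axis,
where the base is positive. The exponents e = -1/2 and e = 1/2 serve F and the incomplete E. -/
theorem analyticAt_of_hasDerivAt_exp_log (hk : k ∈ Ico (0 : ℝ) 1) {F : ℝ → ℝ} (e : ℝ)
    (hF : ∀ x, HasDerivAt F (Real.exp (e * Real.log (1 - k ^ 2 * Real.sin x ^ 2))) x) (x₀ : ℝ) :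
    AnalyticAt ℝ F x₀ := by
  have hre : ∀ x : ℝ, (1 : ℂ) - (k : ℂ) ^ 2 * Complex.sin x ^ 2
      = ((1 - k ^ 2 * Real.sin x ^ 2 : ℝ) : ℂ) := fun x => by push_cast; rfl
  refine analyticAt_of_hasDerivAt_re
    (g := fun z => Complex.exp (e * Complex.log (1 - (k : ℂ) ^ 2 * Complex.sin z ^ 2))) ?_ ?_
  · refine AnalyticAt.cexp' (analyticAt_const.mul (AnalyticAt.clog ?_ ?_))
    · exact analyticAt_const.sub (analyticAt_const.mul (Complex.analyticAt_sin.pow 2))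
    · rw [hre]
      exact Complex.ofReal_mem_slitPlane.2 (one_sub_pos hk x₀)
  · intro x
    refine (hF x).congr_deriv ?_
    rw [hre, ← Complex.ofReal_log (one_sub_pos hk x).le, ← Complex.ofReal_mul,
      ← Complex.ofReal_exp, Complex.ofReal_re]

theorem sqrt_eq_exp_log {x : ℝ} (hx : 0 < x) : √x = Real.exp (1 / 2 * Real.log x) := by
  rw [Real.sqrt_eq_rpow, Real.rpow_def_of_pos hx, mul_comm]

theorem analyticAt_ellF (hk : k ∈ Ico (0 : ℝ) 1) (φ : ℝ) : AnalyticAt ℝ (ellF k) φ := by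
  refine analyticAt_of_hasDerivAt_exp_log hk (-(1 / 2)) (fun x => ?_) φ
  refine (hasDerivAt_ellF hk x).congr_deriv ?_
  rw [sqrt_eq_exp_log (one_sub_pos hk x), one_div, ← Real.exp_neg, neg_mul]

theorem analyticAt_ellEInc (hk : k ∈ Ico (0 : ℝ) 1) (φ : ℝ) : AnalyticAt ℝ (ellEInc k) φ := by
  refine analyticAt_of_hasDerivAt_exp_log hk (1 / 2) (fun x => ?_) φ
  refine (hasDerivAt_ellEInc k x).congr_deriv ?_
  rw [sqrt_eq_exp_log (one_sub_pos hk x)]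

theorem analyticAt_sqrt_integrand (hk : k ∈ Ico (0 : ℝ) 1) (φ : ℝ) :
    AnalyticAt ℝ (fun t => √(1 - k ^ 2 * Real.sin t ^ 2)) φ := by
  have h : ContDiff ℝ (⊤ : WithTop ℕ∞) (fun t : ℝ => √(1 - k ^ 2 * Real.sin t ^ 2)) :=
    ContDiff.sqrt (contDiff_const.sub (contDiff_const.mul (Real.contDiff_sin.pow 2)))
      fun x => (one_sub_pos hk x).ne'
  exact contDiff_omega_iff_analyticOnNhd.1 h φ (mem_univ φ)

/-- As a function of φ = am p, P is built from analytic functions on the whole line. Vanishing on an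
interval would make it vanish at p₁¹, where cn P > 0. -/
theorem exists_x₁Poly_ne_zero (hk : k ∈ Ioo (0 : ℝ) 1) {a b : ℝ} (hab : a < b) :
    ∃ p ∈ Ioo a b, x₁Poly k (sn k p) (cn k p) (dn k p) (jacobiE k p) p ≠ 0 := by
  have hk' : k ∈ Ico (0 : ℝ) 1 := ⟨hk.1.le, hk.2⟩
  by_contra! h
  set G : ℝ → ℝ := fun φ => x₁Poly k (Real.sin φ) (Real.cos φ) (√(1 - k ^ 2 * Real.sin φ ^ 2))
    (ellEInc k φ) (ellF k φ) with hG
  have hGam : ∀ p, G (am k p) = x₁Poly k (sn k p) (cn k p) (dn k p) (jacobiE k p) p := fun p => by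
    simp only [hG, ellF_am hk', jacobiE_eq_ellEInc hk']
    rfl
  have han : AnalyticOnNhd ℝ G univ := fun φ _ => by
    have h1 := analyticAt_ellF hk' φ
    have h2 := analyticAt_ellEInc hk' φ
    have h3 := analyticAt_sqrt_integrand hk' φ
    have h4 : AnalyticAt ℝ Real.sin φ := Real.analyticAt_sin
    have h5 : AnalyticAt ℝ Real.cos φ := Real.analyticAt_cos
    simp only [hG, x₁Poly]
    fun_prop
  obtain ⟨p, hp⟩ := nonempty_Ioo.2 hab
  have hev : G =ᶠ[nhds (am k p)] 0 := by
    have hmem : Ioo (am k a) (am k b) ∈ nhds (am k p) :=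
      Ioo_mem_nhds (am_strictMono hk' hp.1) (am_strictMono hk' hp.2)
    filter_upwards [hmem] with φ hφ
    rw [← am_ellF hk' φ, hGam]
    refine h _ ⟨?_, ?_⟩
    · rw [← (am_strictMono hk').lt_iff_lt, am_ellF hk']; exact hφ.1
    · rw [← (am_strictMono hk').lt_iff_lt, am_ellF hk']; exact hφ.2
  have hz := han.eqOn_zero_of_preconnected_of_eventuallyEq_zero isPreconnected_univ
    (mem_univ _) hev (mem_univ (am k (pF₁ k 1)))
  rw [hGam] at hz
  have := mul_x₁Poly_pos_of_f₁_eq_zero hk ((ellK_pos hk').trans (pF₁_one_mem hk').1)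
    (f₁_pF₁_one hk')
  rw [hz] at this
  simp at this

/-! ### Sign of x₁ and its root -/

theorem monotoneOn_x₁Poly_div_f₁ (hk : k ∈ Ico (0 : ℝ) 1) {s : Set ℝ} (hs : Convex ℝ s)
    (hf : ∀ p ∈ s, f₁ k p ≠ 0) :
    MonotoneOn (fun x => -x₁Poly k (sn k x) (cn k x) (dn k x) (jacobiE k x) x / f₁ k x) s := by
  obtain ⟨g', hg0, hg⟩ := exists_hasDerivAt_x₁Poly_div_f₁ hk
  refine monotoneOn_of_deriv_nonneg hs
    (fun y hy => (hg y (hf y hy)).continuousAt.continuousWithinAt)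
    (fun y hy => (hg y (hf y (interior_subset hy))).differentiableAt.differentiableWithinAt)
    (fun y hy => ?_)
  rw [(hg y (hf y (interior_subset hy))).deriv]
  exact hg0 y

/-- By monotonicity the value at p is at least the value at every smaller x > 0, and those dominate
a function tending to 0. -/
theorem x₁Poly_div_f₁_nonneg (hk : k ∈ Ioo (0 : ℝ) 1) {p : ℝ} (h0 : 0 < p)
    (h1 : p < pF₁ k 1) :
    0 ≤ -x₁Poly k (sn k p) (cn k p) (dn k p) (jacobiE k p) p / f₁ k p := by
  have hk' : k ∈ Ico (0 : ℝ) 1 := ⟨hk.1.le, hk.2⟩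
  have hl : 0 < 1 - k ^ 2 := by nlinarith [hk.1, hk.2]
  have hm := monotoneOn_x₁Poly_div_f₁ hk' (convex_Ioo 0 (pF₁ k 1))
    fun x hx => (f₁_pos hk' hx.1 hx.2).ne'
  have hcont : ContinuousAt (fun p =>
      (-(k ^ 2 * ((p - jacobiE k p) + 3 * (1 - k ^ 2) * sn k p * jacobiE k p ^ 2)
        / ((1 - k ^ 2) * cn k p))
      - (2 * k ^ 2 * cn k p ^ 2 * (sn k p * dn k p + cn k p * (2 * jacobiE k p - p))
        + cn k p * (p * (1 - k ^ 2 * (5 - 4 * k ^ 2) * sn k p ^ 2)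
          - (1 + 4 * k ^ 2 - 6 * k ^ 2 * sn k p ^ 2) * jacobiE k p)
        - sn k p * dn k p * (jacobiE k p ^ 2 - 2 * (1 - k ^ 2) * p * jacobiE k p
          + (1 - k ^ 2) * p ^ 2))) / cn k p) 0 := by
    have h1 := (continuous_sn hk').continuousAt (x := 0)
    have h2 := (continuous_cn hk').continuousAt (x := 0)
    have h3 := (continuous_dn hk').continuousAt (x := 0)
    have h4 := (continuous_jacobiE hk').continuousAt (x := 0)
    have h5 : cn k 0 ≠ 0 := by simp [cn_zero hk']
    have h6 : (1 - k ^ 2) * cn k 0 ≠ 0 := mul_ne_zero hl.ne' h5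
    fun_prop (disch := assumption)
  have ht := hcont.tendsto.mono_left (nhdsWithin_le_nhds (s := Ioi 0))
  simp only [sn_zero hk', cn_zero hk', jacobiE_zero] at ht
  norm_num at ht
  refine le_of_tendsto ht ?_
  filter_upwards [Ioo_mem_nhdsGT h0, Ioo_mem_nhdsGT (ellK_pos hk')] with x hx hxK
  exact (x₁Poly_div_f₁_ge hk hx.1 hxK.2).trans
    (hm ⟨hx.1, hx.2.trans h1⟩ ⟨h0, h1⟩ hx.2.le)

/-- If the nonnegative, nondecreasing quotient were ≤ 0 at p, it would be 0 on (0, p), and P would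
vanish on an interval. -/
theorem x₁_pos (hk : k ∈ Ioo (0 : ℝ) 1) {p : ℝ} (h0 : 0 < p) (h1 : p < pF₁ k 1) :
    0 < x₁ k p := by
  have hk' : k ∈ Ico (0 : ℝ) 1 := ⟨hk.1.le, hk.2⟩
  rw [x₁_eq, neg_mul, ← mul_neg]
  refine mul_pos (dn_pos hk' p) ?_
  by_contra! hn
  have hm := monotoneOn_x₁Poly_div_f₁ hk' (convex_Ioo 0 (pF₁ k 1))
    fun x hx => (f₁_pos hk' hx.1 hx.2).ne'
  obtain ⟨x, hx, hx0⟩ := exists_x₁Poly_ne_zero hk h0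
  have hx1 : x < pF₁ k 1 := hx.2.trans h1
  have h2 := (hm ⟨hx.1, hx1⟩ ⟨h0, h1⟩ hx.2.le).trans
    (div_nonpos_of_nonpos_of_nonneg hn (f₁_pos hk' h0 h1).le)
  have h3 := le_antisymm h2 (x₁Poly_div_f₁_nonneg hk hx.1 hx1)
  rw [div_eq_zero_iff, neg_eq_zero] at h3
  exact h3.elim hx0 (f₁_pos hk' hx.1 hx1).ne'

/-- A monotone quotient with two zeros vanishes between them, which analyticity excludes. -/
theorem x₁_root_unique (hk : k ∈ Ioo (0 : ℝ) 1) {a b : ℝ}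
    (ha : a ∈ Ioo (pF₁ k 1) (pF₁ k 2)) (hb : b ∈ Ioo (pF₁ k 1) (pF₁ k 2))
    (fa : x₁ k a = 0) (fb : x₁ k b = 0) : a = b := by
  have hk' : k ∈ Ico (0 : ℝ) 1 := ⟨hk.1.le, hk.2⟩
  wlog hab : a < b generalizing a b
  · rcases lt_trichotomy a b with h | h | h
    · exact absurd h hab
    · exact h
    · exact (this hb ha fb fa h).symm
  exfalso
  have hm := monotoneOn_x₁Poly_div_f₁ hk' (convex_Ioo (pF₁ k 1) (pF₁ k 2))
    fun x hx => (f₁_neg hk' hx.1 hx.2).ne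
  rw [x₁_eq, mul_eq_zero, neg_eq_zero, or_iff_right (dn_pos hk' _).ne'] at fa fb
  obtain ⟨x, hx, hx0⟩ := exists_x₁Poly_ne_zero hk hab
  have hx' : x ∈ Ioo (pF₁ k 1) (pF₁ k 2) := ⟨ha.1.trans hx.1, hx.2.trans hb.2⟩
  have h1 := hm ha hx' hx.1.le
  have h2 := hm hx' hb hx.2.le
  simp only [fa, fb, neg_zero, zero_div] at h1 h2
  have h3 := le_antisymm h2 h1
  rw [div_eq_zero_iff, neg_eq_zero] at h3
  exact h3.elim hx0 (f₁_neg hk' hx'.1 hx'.2).ne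

theorem pF₁_one_lt_pF₁_two (hk : k ∈ Ico (0 : ℝ) 1) : pF₁ k 1 < pF₁ k 2 :=
  (pF₁_one_mem hk).2.trans (pF₁_two_mem hk).1

theorem rootsX₁_one_eq (hk : k ∈ Ioo (0 : ℝ) 1) : rootsX₁ k 1 = {pX₁ k 1} := by
  have hk' : k ∈ Ico (0 : ℝ) 1 := ⟨hk.1.le, hk.2⟩
  obtain ⟨r, hr, hr0⟩ := intermediate_value_Ioo' (pF₁_one_lt_pF₁_two hk').le
    (continuous_x₁ hk').continuousOn ⟨x₁_pF₁_two_neg hk, x₁_pF₁_one_pos hk⟩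
  have : rootsX₁ k 1 = {r} := by
    ext x
    exact ⟨fun h => x₁_root_unique hk h.1 hr h.2 hr0, fun h => h ▸ ⟨hr, hr0⟩⟩
  rw [pX₁, this, csInf_singleton]

theorem pX₁_mem (hk : k ∈ Ioo (0 : ℝ) 1) :
    pX₁ k 1 ∈ Ioo (pF₁ k 1) (pF₁ k 2) ∧ x₁ k (pX₁ k 1) = 0 := by
  have h : pX₁ k 1 ∈ rootsX₁ k 1 := rootsX₁_one_eq hk ▸ mem_singleton _
  exact h

theorem eq_pX₁ (hk : k ∈ Ioo (0 : ℝ) 1) {p : ℝ} (hp : p ∈ Ioo (pF₁ k 1) (pF₁ k 2))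
    (h : x₁ k p = 0) : p = pX₁ k 1 := by
  have : p ∈ rootsX₁ k 1 := ⟨hp, h⟩
  rwa [rootsX₁_one_eq hk] at this

theorem x₁_pos_of_lt_pX₁ (hk : k ∈ Ioo (0 : ℝ) 1) {p : ℝ} (h0 : 0 < p) (h1 : p < pX₁ k 1) :
    0 < x₁ k p := by
  have hk' : k ∈ Ico (0 : ℝ) 1 := ⟨hk.1.le, hk.2⟩
  rcases lt_or_ge p (pF₁ k 1) with h | h
  · exact x₁_pos hk h0 h
  by_contra! hn
  obtain ⟨y, hy, hy0⟩ := intermediate_value_Icc' h (continuous_x₁ hk').continuousOn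
    ⟨hn, (x₁_pF₁_one_pos hk).le⟩
  have hne : y ≠ pF₁ k 1 := fun h => by
    have := x₁_pF₁_one_pos hk
    rw [← h, hy0] at this
    exact lt_irrefl _ this
  have := eq_pX₁ hk ⟨lt_of_le_of_ne hy.1 hne.symm, by linarith [hy.2, (pX₁_mem hk).1.2]⟩ hy0
  linarith [hy.2]

theorem x₁_neg (hk : k ∈ Ioo (0 : ℝ) 1) {p : ℝ} (h0 : pX₁ k 1 < p) (h1 : p < pF₁ k 2) :
    x₁ k p < 0 := by
  have hk' : k ∈ Ico (0 : ℝ) 1 := ⟨hk.1.le, hk.2⟩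
  by_contra! hn
  obtain ⟨y, hy, hy0⟩ := intermediate_value_Icc' h1.le (continuous_x₁ hk').continuousOn
    ⟨(x₁_pF₁_two_neg hk).le, hn⟩
  have hne : y ≠ pF₁ k 2 := fun h => by
    have := x₁_pF₁_two_neg hk
    rw [← h, hy0] at this
    exact lt_irrefl _ this
  have := eq_pX₁ hk ⟨by linarith [hy.1, (pX₁_mem hk).1.1], lt_of_le_of_ne hy.2 hne⟩ hy0
  linarith [hy.1]

/-! ### The modulus k₀ -/

theorem two_ellE_sub_ellK_eq (hk : k ∈ Ico (0 : ℝ) 1) : 2 * ellE k - ellK k =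
    ∫ t in (0 : ℝ)..(Real.pi / 2),
      (2 * √(1 - k ^ 2 * Real.sin t ^ 2) - 1 / √(1 - k ^ 2 * Real.sin t ^ 2)) := by
  rw [intervalIntegral.integral_sub
    (((continuous_sqrt_integrand k).const_mul 2).intervalIntegrable _ _)
    ((continuous_integrand hk).intervalIntegrable _ _), intervalIntegral.integral_const_mul]
  rfl

theorem two_ellE_sub_ellK_strictAntiOn :
    StrictAntiOn (fun k => 2 * ellE k - ellK k) (Ico (0 : ℝ) 1) := by
  intro a ha b hb hab
  simp only [two_ellE_sub_ellK_eq ha, two_ellE_sub_ellK_eq hb]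
  have hpi : (0 : ℝ) < Real.pi / 2 := by positivity
  have hab2 : a ^ 2 < b ^ 2 := pow_lt_pow_left₀ hab ha.1 two_ne_zero
  have hle : ∀ t, √(1 - b ^ 2 * Real.sin t ^ 2) ≤ √(1 - a ^ 2 * Real.sin t ^ 2) := fun t =>
    Real.sqrt_le_sqrt (by nlinarith [sq_nonneg (Real.sin t)])
  refine intervalIntegral.integral_lt_integral_of_continuousOn_of_le_of_exists_lt hpi
    (((continuous_sqrt_integrand b).const_mul 2).sub (continuous_integrand hb)).continuousOn
    (((continuous_sqrt_integrand a).const_mul 2).sub (continuous_integrand ha)).continuousOn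
    -- Strictness is checked at t = π/2, where sin t = 1; at t = 0 the integrand does not depend on
    -- k.
    (fun t _ => ?_) ⟨Real.pi / 2, ⟨hpi.le, le_rfl⟩, ?_⟩
  · have := one_div_le_one_div_of_le (Real.sqrt_pos.2 (one_sub_pos hb t)) (hle t)
    linarith [hle t]
  · have h1 : √(1 - b ^ 2 * Real.sin (Real.pi / 2) ^ 2)
        < √(1 - a ^ 2 * Real.sin (Real.pi / 2) ^ 2) :=
      Real.sqrt_lt_sqrt (one_sub_pos hb _).le (by simp; exact hab2)
    have := one_div_le_one_div_of_le (Real.sqrt_pos.2 (one_sub_pos hb _)) h1.le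
    linarith

theorem two_ellE_sub_ellK_continuousOn {k₁ : ℝ} (h1 : k₁ < 1) :
    ContinuousOn (fun k => 2 * ellE k - ellK k) (Icc 0 k₁) := by
  -- Clamping the modulus to stay in [0, 1) makes the integrand continuous on the whole plane.
  have hmem : ∀ x : ℝ, max 0 (min x k₁) ∈ Ico (0 : ℝ) 1 := fun x =>
    ⟨le_max_left _ _, max_lt one_pos ((min_le_right _ _).trans_lt h1)⟩
  have hc : Continuous fun x : ℝ => ∫ t in (0 : ℝ)..(Real.pi / 2),
      (2 * √(1 - (max 0 (min x k₁)) ^ 2 * Real.sin t ^ 2)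
        - 1 / √(1 - (max 0 (min x k₁)) ^ 2 * Real.sin t ^ 2)) := by
    refine intervalIntegral.continuous_parametric_intervalIntegral_of_continuous' ?_ _ _
    have hs : Continuous fun q : ℝ × ℝ =>
        √(1 - (max 0 (min q.1 k₁)) ^ 2 * Real.sin q.2 ^ 2) := by fun_prop
    refine (hs.const_mul 2).sub (continuous_const.div hs fun q => ?_)
    exact (Real.sqrt_pos.2 (one_sub_pos (hmem q.1) q.2)).ne'
  refine hc.continuousOn.congr fun x hx => ?_
  simp only [min_eq_left hx.2, max_eq_right hx.1]
  exact two_ellE_sub_ellK_eq ⟨hx.1, hx.2.trans_lt h1⟩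

theorem ellE_le (k : ℝ) : ellE k ≤ Real.pi / 2 := by
  calc ellE k ≤ ∫ _ in (0 : ℝ)..(Real.pi / 2), (1 : ℝ) :=
        intervalIntegral.integral_mono_on (by positivity)
          ((continuous_sqrt_integrand k).intervalIntegrable _ _) (by simp)
          fun t _ => Real.sqrt_le_one.2 (by nlinarith [sq_nonneg (k * Real.sin t)])
    _ = Real.pi / 2 := by simp

/-- Here 1 - k² sin² t = cos² t + δ² sin² t ≤ (π/2 - t + δ)², since cos t ≤ π/2 - t; the bound on
the integrand integrates to a logarithm. -/
theorem log_le_ellK (hk : k ∈ Ico (0 : ℝ) 1) {δ : ℝ} (hδ : 0 < δ) (h : k ^ 2 = 1 - δ ^ 2) :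
    Real.log (Real.pi / 2 + δ) - Real.log δ ≤ ellK k := by
  have hpi : (0 : ℝ) ≤ Real.pi / 2 := by positivity
  have hpos : ∀ t ∈ Icc 0 (Real.pi / 2), 0 < Real.pi / 2 - t + δ := fun t ht => by
    linarith [ht.2]
  have hcont : ContinuousOn (fun t => 1 / (Real.pi / 2 - t + δ)) (Icc 0 (Real.pi / 2)) :=
    continuousOn_const.div (by fun_prop) fun t ht => (hpos t ht).ne'
  have hint : ∫ t in (0 : ℝ)..(Real.pi / 2), 1 / (Real.pi / 2 - t + δ)
      = Real.log (Real.pi / 2 + δ) - Real.log δ := by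
    rw [intervalIntegral.integral_eq_sub_of_hasDerivAt
      (f := fun t => -Real.log (Real.pi / 2 - t + δ)) ?_ ?_]
    · simp
      ring
    · intro t ht
      rw [uIcc_of_le hpi] at ht
      refine ((((hasDerivAt_id t).const_sub (Real.pi / 2)).add_const δ).log
        (hpos t ht).ne').neg.congr_deriv ?_
      simp only [id]
      ring
    · refine ContinuousOn.intervalIntegrable ?_
      rwa [uIcc_of_le hpi]
  rw [← hint]
  refine intervalIntegral.integral_mono_on hpi (ContinuousOn.intervalIntegrable ?_)
    ((continuous_integrand hk).intervalIntegrable _ _) fun t ht => ?_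
  · rwa [uIcc_of_le hpi]
  · refine one_div_le_one_div_of_le (Real.sqrt_pos.2 (one_sub_pos hk t)) ?_
    rw [Real.sqrt_le_left (hpos t ht).le, h]
    have h1 : Real.cos t ≤ Real.pi / 2 - t := by
      rw [← Real.sin_pi_div_two_sub]
      exact Real.sin_le (by linarith [ht.2])
    have h2 : 0 ≤ Real.cos t :=
      Real.cos_nonneg_of_mem_Icc ⟨by linarith [ht.1], ht.2⟩
    have h3 := Real.sin_sq_add_cos_sq t
    have h4 : 0 ≤ Real.pi / 2 - t := by linarith [ht.2]
    nlinarith [mul_nonneg h4 hδ.le, mul_nonneg (sq_nonneg δ) (sq_nonneg (Real.cos t)),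
      pow_le_pow_left₀ h2 h1 2]

theorem exists_two_ellE_sub_ellK_neg : ∃ k ∈ Ico (0 : ℝ) 1, 2 * ellE k - ellK k < 0 := by
  -- With -log δ = 4 one gets K ≥ 4 > π ≥ 2E.
  set δ := Real.exp (-4) with hδ
  have hδ0 : 0 < δ := Real.exp_pos _
  have hδ1 : δ < 1 := by simp [hδ]
  have hδ2 : 0 ≤ 1 - δ ^ 2 := by nlinarith
  have hk : √(1 - δ ^ 2) ∈ Ico (0 : ℝ) 1 :=
    ⟨Real.sqrt_nonneg _, by rw [Real.sqrt_lt' one_pos]; nlinarith⟩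
  refine ⟨_, hk, ?_⟩
  have h1 := log_le_ellK hk hδ0 (Real.sq_sqrt hδ2)
  have h2 := ellE_le (√(1 - δ ^ 2))
  have h3 : 0 ≤ Real.log (Real.pi / 2 + δ) :=
    Real.log_nonneg (by linarith [Real.pi_gt_three])
  rw [hδ, Real.log_exp, ← hδ] at h1
  linarith [Real.pi_lt_four]

theorem exists_root_two_ellE_sub_ellK :
    ∃ r ∈ Ioo (0 : ℝ) 1, 2 * ellE r - ellK r = 0 := by
  obtain ⟨k₁, hk₁, hneg⟩ := exists_two_ellE_sub_ellK_neg
  have h0 : 0 < 2 * ellE 0 - ellK 0 := by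
    have h1 : ellE 0 = Real.pi / 2 := by simp [ellE]
    have h2 : ellK 0 = Real.pi / 2 := by simp [ellK, ellF]
    rw [h1, h2]
    linarith [Real.pi_pos]
  obtain ⟨r, hr, hr0⟩ := intermediate_value_Ioo' hk₁.1
    (two_ellE_sub_ellK_continuousOn hk₁.2) ⟨hneg, h0⟩
  exact ⟨r, ⟨hr.1, hr.2.trans hk₁.2⟩, hr0⟩

theorem roots_two_ellE_sub_ellK :
    {k : ℝ | k ∈ Ico (0 : ℝ) 1 ∧ 2 * ellE k - ellK k = 0} = {k₀} ∧ k₀ ∈ Ioo (0 : ℝ) 1 := by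
  obtain ⟨r, hr, hr0⟩ := exists_root_two_ellE_sub_ellK
  have hr' : r ∈ Ico (0 : ℝ) 1 := ⟨hr.1.le, hr.2⟩
  have h : {k : ℝ | k ∈ Ico (0 : ℝ) 1 ∧ 2 * ellE k - ellK k = 0} = {r} := by
    ext x
    refine ⟨fun hx => ?_, fun hx => ?_⟩
    · exact two_ellE_sub_ellK_strictAntiOn.injOn hx.1 hr' (hx.2.trans hr0.symm)
    · rw [mem_singleton_iff] at hx
      exact hx ▸ ⟨hr', hr0⟩
  have hk₀ : k₀ = r := by rw [k₀, h, csInf_singleton]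
  rw [hk₀]
  exact ⟨h, hr⟩

theorem two_ellE_sub_ellK_k₀ : 2 * ellE k₀ - ellK k₀ = 0 := by
  have h : k₀ ∈ {k : ℝ | k ∈ Ico (0 : ℝ) 1 ∧ 2 * ellE k - ellK k = 0} :=
    roots_two_ellE_sub_ellK.1 ▸ mem_singleton _
  exact h.2

/-! ### Sign of J₁ and existence of its first root -/

variable {z : ℝ}

/-- The weight of sn x₁ is (1 - k²) z + k² z - k² z², which factors; the problem becomes one about
signs of functions that do not involve z. -/
theorem J₁_eq (k z p : ℝ) : J₁ k z p =
    (1 - z) * (f₁ k p * x₂ k p) + z * (1 - k ^ 2 * z) * (sn k p * x₁ k p) := by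
  rw [J₁, a₁, a₂, a₀]
  ring

theorem continuous_J₁ (hk : k ∈ Ico (0 : ℝ) 1) (z : ℝ) : Continuous (J₁ k z) := by
  have h1 := continuous_sn hk
  have h2 := continuous_x₁ hk
  have h3 := continuous_x₂ hk
  have h4 := continuous_f₁ hk
  have h : J₁ k z = fun p =>
      (1 - z) * (f₁ k p * x₂ k p) + z * (1 - k ^ 2 * z) * (sn k p * x₁ k p) :=
    funext fun p => J₁_eq k z p
  rw [h]
  fun_prop

theorem one_sub_sq_mul_pos (hk : k ∈ Ico (0 : ℝ) 1) (hz : z ∈ Icc (0 : ℝ) 1) :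
    0 < 1 - k ^ 2 * z := by
  have h1 : k ^ 2 < 1 := by nlinarith [hk.1, hk.2]
  nlinarith [hz.1, hz.2, sq_nonneg k]

theorem J₁_pos (hk : k ∈ Ico (0 : ℝ) 1) (hz : z ∈ Icc (0 : ℝ) 1) {p : ℝ}
    (h0 : 0 < f₁ k p * x₂ k p) (h1 : 0 < sn k p * x₁ k p) : 0 < J₁ k z p := by
  rw [J₁_eq]
  have hw := one_sub_sq_mul_pos hk hz
  have hz1 : 0 ≤ 1 - z := sub_nonneg.2 hz.2
  rcases hz.1.eq_or_lt with h | h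
  · rw [← h]
    simpa using h0
  · have := mul_nonneg hz1 h0.le
    positivity

theorem J₁_neg (hk : k ∈ Ico (0 : ℝ) 1) (hz : z ∈ Icc (0 : ℝ) 1) {p : ℝ}
    (h0 : f₁ k p * x₂ k p < 0) (h1 : sn k p * x₁ k p < 0) : J₁ k z p < 0 := by
  rw [J₁_eq]
  have hw := one_sub_sq_mul_pos hk hz
  have hz1 : 0 ≤ 1 - z := sub_nonneg.2 hz.2
  rcases hz.1.eq_or_lt with h | h
  · rw [← h]
    simpa using h0
  · exact add_neg_of_nonpos_of_neg (mul_nonpos_of_nonneg_of_nonpos hz1 h0.le)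
      (mul_neg_of_pos_of_neg (mul_pos h hw) h1)

theorem J₁_nonpos (hk : k ∈ Ico (0 : ℝ) 1) (hz : z ∈ Icc (0 : ℝ) 1) {p : ℝ}
    (h0 : f₁ k p * x₂ k p ≤ 0) (h1 : sn k p * x₁ k p ≤ 0) : J₁ k z p ≤ 0 := by
  rw [J₁_eq]
  have hw := one_sub_sq_mul_pos hk hz
  exact add_nonpos (mul_nonpos_of_nonneg_of_nonpos (sub_nonneg.2 hz.2) h0)
    (mul_nonpos_of_nonneg_of_nonpos (mul_nonneg hz.1 hw.le) h1)

theorem J₁_pos_of_lt (hk : k ∈ Ioo (0 : ℝ) 1) (hz : z ∈ Icc (0 : ℝ) 1) {p : ℝ} (h0 : 0 < p)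
    (h1 : p < pF₁ k 1) (h2 : p < 2 * ellK k) : 0 < J₁ k z p := by
  have hk' : k ∈ Ico (0 : ℝ) 1 := ⟨hk.1.le, hk.2⟩
  exact J₁_pos hk' hz (mul_pos (f₁_pos hk' h0 h1) (x₂_pos hk h0 (Or.inl h2.le)))
    (mul_pos (sn_pos hk' h0 h2) (x₁_pos hk h0 h1))

/-- Positivity on (0, A) keeps the roots away from 0, so the set of positive roots is closed and its
infimum is attained. The intermediate value theorem starts at A / 2, as the sign at A is not given.
-/
theorem isLeast_pConj (hk : k ∈ Ico (0 : ℝ) 1) {A B : ℝ} (hA : 0 < A) (hAB : A ≤ B)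
    (hpos : ∀ p ∈ Ioo 0 A, 0 < J₁ k z p) (hB : J₁ k z B ≤ 0) :
    IsLeast (rootsJ₁ k z) (pConj k z) ∧ pConj k z ∈ Icc A B := by
  have hlb : ∀ p ∈ rootsJ₁ k z, A ≤ p := fun p hp => by
    by_contra! h
    exact (hpos p ⟨hp.1, h⟩).ne' hp.2
  obtain ⟨y, hy, hy0⟩ := intermediate_value_Icc' (by linarith : A / 2 ≤ B)
    (continuous_J₁ hk z).continuousOn ⟨hB, (hpos (A / 2) ⟨by linarith, by linarith⟩).le⟩
  have hyr : y ∈ rootsJ₁ k z := ⟨by linarith [hy.1], hy0⟩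
  have hbdd : BddBelow (rootsJ₁ k z) := ⟨A, hlb⟩
  have hset : rootsJ₁ k z = Ici A ∩ J₁ k z ⁻¹' {0} := by
    ext p
    exact ⟨fun hp => ⟨hlb p hp, hp.2⟩, fun hp => ⟨hA.trans_le hp.1, hp.2⟩⟩
  have hclosed : IsClosed (rootsJ₁ k z) := by
    rw [hset]
    exact isClosed_Ici.inter (isClosed_singleton.preimage (continuous_J₁ hk z))
  have hmem : pConj k z ∈ rootsJ₁ k z := hclosed.csInf_mem ⟨y, hyr⟩ hbdd
  exact ⟨⟨hmem, fun p hp => csInf_le hbdd hp⟩, hlb _ hmem, (csInf_le hbdd hyr).trans hy.2⟩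

/-- x₂ stays positive near a by continuity. None of f₁, x₁, x₂ depends on z, so one ε serves all z.
-/
theorem exists_J₁_neg_right (hk : k ∈ Ico (0 : ℝ) 1) {a b : ℝ} (ha : 0 < x₂ k a) (hab : a < b)
    (hf : ∀ p ∈ Ioo a b, f₁ k p < 0) (hs : ∀ p ∈ Ioo a b, sn k p * x₁ k p < 0) :
    ∃ ε : ℝ, 0 < ε ∧ ∀ z ∈ Icc (0 : ℝ) 1, ∀ p ∈ Ioo a (a + ε), J₁ k z p < 0 := by
  obtain ⟨r, hr, hball⟩ := Metric.eventually_nhds_iff_ball.1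
    ((continuous_x₂ hk).continuousAt.eventually (lt_mem_nhds ha))
  refine ⟨min r (b - a), lt_min hr (sub_pos.2 hab), fun z hz p hp => ?_⟩
  have h1 : p < a + r := hp.2.trans_le (by linarith [min_le_left r (b - a)])
  have h2 : p ∈ Ioo a b := ⟨hp.1, hp.2.trans_le (by linarith [min_le_right r (b - a)])⟩
  have h3 : p ∈ Metric.ball a r := by
    rw [Real.ball_eq_Ioo]
    exact ⟨by linarith [hp.1], h1⟩
  exact J₁_neg hk hz (mul_neg_of_neg_of_pos (hf p h2) (hball p h3)) (hs p h2)

/-! ### The order of 2K and p₁¹, and the three cases -/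

theorem two_ellK_lt_pF₁ (hk : k ∈ Ioo (0 : ℝ) 1) (h : k < k₀) : 2 * ellK k < pF₁ k 1 := by
  have hk' : k ∈ Ico (0 : ℝ) 1 := ⟨hk.1.le, hk.2⟩
  have hk₀ := roots_two_ellE_sub_ellK.2
  have h1 := two_ellE_sub_ellK_strictAntiOn hk' ⟨hk₀.1.le, hk₀.2⟩ h
  simp only [two_ellE_sub_ellK_k₀] at h1
  have h2 : 0 < f₁ k (2 * ellK k) := by rw [f₁_two_ellK hk']; linarith
  by_contra! hn
  rcases hn.lt_or_eq with h3 | h3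
  · exact h2.not_gt (f₁_neg hk' h3 (by linarith [(pF₁_two_mem hk').1, ellK_pos hk']))
  · rw [← h3, f₁_pF₁_one hk'] at h2
    exact lt_irrefl _ h2

theorem two_ellK_eq_pF₁ (hk : k ∈ Ioo (0 : ℝ) 1) (h : k = k₀) : 2 * ellK k = pF₁ k 1 := by
  have hk' : k ∈ Ico (0 : ℝ) 1 := ⟨hk.1.le, hk.2⟩
  have hK := ellK_pos hk'
  refine eq_pF₁_one hk' ⟨by linarith, by linarith⟩ ?_
  rw [f₁_two_ellK hk', h, two_ellE_sub_ellK_k₀, mul_zero]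

theorem f₁_two_ellK_neg (hk : k ∈ Ioo (0 : ℝ) 1) (h : k₀ < k) : f₁ k (2 * ellK k) < 0 := by
  have hk' : k ∈ Ico (0 : ℝ) 1 := ⟨hk.1.le, hk.2⟩
  have hk₀ := roots_two_ellE_sub_ellK.2
  have h1 := two_ellE_sub_ellK_strictAntiOn ⟨hk₀.1.le, hk₀.2⟩ hk' h
  simp only [two_ellE_sub_ellK_k₀] at h1
  rw [f₁_two_ellK hk']
  linarith

theorem pF₁_lt_two_ellK (hk : k ∈ Ioo (0 : ℝ) 1) (h : k₀ < k) : pF₁ k 1 < 2 * ellK k := by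
  have hk' : k ∈ Ico (0 : ℝ) 1 := ⟨hk.1.le, hk.2⟩
  have hK := ellK_pos hk'
  have h2 := f₁_two_ellK_neg hk h
  by_contra! hn
  rcases hn.lt_or_eq with h3 | h3
  · exact h2.not_gt (f₁_pos hk' (by linarith) h3)
  · rw [h3, f₁_pF₁_one hk'] at h2
    exact lt_irrefl _ h2

/-- Right of p₁¹ one has f₁ < 0; moreover sn < 0 until 4K and x₁ > 0 until its root, whence the
minimum of the two as right end. -/
theorem exists_J₁_neg_right_pF₁ (hk : k ∈ Ioo (0 : ℝ) 1) (h : 2 * ellK k ≤ pF₁ k 1) :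
    ∃ ε : ℝ, 0 < ε ∧ ∀ z ∈ Icc (0 : ℝ) 1, ∀ p ∈ Ioo (pF₁ k 1) (pF₁ k 1 + ε), J₁ k z p < 0 := by
  have hk' : k ∈ Ico (0 : ℝ) 1 := ⟨hk.1.le, hk.2⟩
  have hK := ellK_pos hk'
  have hm := pF₁_one_mem hk'
  have hX := (pX₁_mem hk).1
  refine exists_J₁_neg_right hk' (b := min (pX₁ k 1) (4 * ellK k))
    (x₂_pos hk (by linarith [hm.1]) (Or.inr le_rfl)) (lt_min hX.1 (by linarith [hm.2]))
    (fun p hp => f₁_neg hk' hp.1 ((hp.2.trans_le (min_le_left _ _)).trans hX.2))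
    (fun p hp => mul_neg_of_neg_of_pos
      (sn_neg hk' (h.trans_lt hp.1) (hp.2.trans_le (min_le_right _ _)))
      (x₁_pos_of_lt_pX₁ hk (by linarith [hm.1, hp.1]) (hp.2.trans_le (min_le_left _ _))))

/-- Before 2K sn is still positive, so sn x₁ becomes negative only when x₁ changes sign. -/
theorem exists_J₁_neg_right_pX₁ (hk : k ∈ Ioo (0 : ℝ) 1) (h : pX₁ k 1 < 2 * ellK k) :
    ∃ ε : ℝ, 0 < ε ∧ ∀ z ∈ Icc (0 : ℝ) 1, ∀ p ∈ Ioo (pX₁ k 1) (pX₁ k 1 + ε), J₁ k z p < 0 := by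
  have hk' : k ∈ Ico (0 : ℝ) 1 := ⟨hk.1.le, hk.2⟩
  have hK := ellK_pos hk'
  have hm := pF₁_one_mem hk'
  have hm2 := pF₁_two_mem hk'
  have hX := (pX₁_mem hk).1
  refine exists_J₁_neg_right hk' (b := 2 * ellK k)
    (x₂_pos hk (by linarith [hm.1, hX.1]) (Or.inl h.le)) h
    (fun p hp => f₁_neg hk' (hX.1.trans hp.1) (by linarith [hp.2, hm2.1]))
    (fun p hp => mul_neg_of_pos_of_neg
      (sn_pos hk' (by linarith [hp.1, hX.1, hm.1]) hp.2)
      (x₁_neg hk hp.1 (by linarith [hp.2, hm2.1])))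

theorem exists_J₁_neg_right_two_ellK (hk : k ∈ Ioo (0 : ℝ) 1) (h₀ : pF₁ k 1 < 2 * ellK k)
    (h : 2 * ellK k < pX₁ k 1) :
    ∃ ε : ℝ, 0 < ε ∧ ∀ z ∈ Icc (0 : ℝ) 1, ∀ p ∈ Ioo (2 * ellK k) (2 * ellK k + ε),
      J₁ k z p < 0 := by
  have hk' : k ∈ Ico (0 : ℝ) 1 := ⟨hk.1.le, hk.2⟩
  have hK := ellK_pos hk'
  have hX := (pX₁_mem hk).1
  refine exists_J₁_neg_right hk' (b := min (pX₁ k 1) (4 * ellK k))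
    (x₂_pos hk (by linarith) (Or.inl le_rfl)) (lt_min h (by linarith))
    (fun p hp => f₁_neg hk' (h₀.trans hp.1) ((hp.2.trans_le (min_le_left _ _)).trans hX.2))
    (fun p hp => mul_neg_of_neg_of_pos
      (sn_neg hk' hp.1 (hp.2.trans_le (min_le_right _ _)))
      (x₁_pos_of_lt_pX₁ hk (by linarith [hp.1]) (hp.2.trans_le (min_le_left _ _))))

theorem J₁_pF₁_nonpos (hk : k ∈ Ioo (0 : ℝ) 1) (hz : z ∈ Icc (0 : ℝ) 1)
    (h : 2 * ellK k ≤ pF₁ k 1) : J₁ k z (pF₁ k 1) ≤ 0 := by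
  have hk' : k ∈ Ico (0 : ℝ) 1 := ⟨hk.1.le, hk.2⟩
  have hs : sn k (pF₁ k 1) ≤ 0 := by
    rcases h.lt_or_eq with h1 | h1
    · exact (sn_neg hk' h1 (by linarith [(pF₁_one_mem hk').2, ellK_pos hk'])).le
    · rw [← h1, sn_two_ellK hk']
  exact J₁_nonpos hk' hz (by rw [f₁_pF₁_one hk', zero_mul])
    (mul_nonpos_of_nonpos_of_nonneg hs (x₁_pF₁_one_pos hk).le)

theorem J₁_two_ellK_nonpos (hk : k ∈ Ioo (0 : ℝ) 1) (hz : z ∈ Icc (0 : ℝ) 1) (h : k₀ < k) :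
    J₁ k z (2 * ellK k) ≤ 0 := by
  have hk' : k ∈ Ico (0 : ℝ) 1 := ⟨hk.1.le, hk.2⟩
  have hK := ellK_pos hk'
  exact J₁_nonpos hk' hz (mul_nonpos_of_nonpos_of_nonneg (f₁_two_ellK_neg hk h).le
    (x₂_pos hk (by linarith) (Or.inl le_rfl)).le) (by rw [sn_two_ellK hk', zero_mul])

theorem isLeast_pConj_of_le (hk : k ∈ Ioo (0 : ℝ) 1) (hz : z ∈ Icc (0 : ℝ) 1)
    (h : 2 * ellK k ≤ pF₁ k 1) :
    IsLeast (rootsJ₁ k z) (pConj k z) ∧ pConj k z ∈ Icc (2 * ellK k) (pF₁ k 1) := by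
  have hk' : k ∈ Ico (0 : ℝ) 1 := ⟨hk.1.le, hk.2⟩
  have hK := ellK_pos hk'
  exact isLeast_pConj hk' (by linarith) h
    (fun p hp => J₁_pos_of_lt hk hz hp.1 (hp.2.trans_le h) hp.2) (J₁_pF₁_nonpos hk hz h)

theorem isLeast_pConj_of_k₀_lt (hk : k ∈ Ioo (0 : ℝ) 1) (hz : z ∈ Icc (0 : ℝ) 1) (h : k₀ < k) :
    IsLeast (rootsJ₁ k z) (pConj k z) ∧ pConj k z ∈ Icc (pF₁ k 1) (2 * ellK k) := by
  have hk' : k ∈ Ico (0 : ℝ) 1 := ⟨hk.1.le, hk.2⟩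
  have h1 := pF₁_lt_two_ellK hk h
  exact isLeast_pConj hk' ((ellK_pos hk').trans (pF₁_one_mem hk').1) h1.le
    (fun p hp => J₁_pos_of_lt hk hz hp.1 hp.2 (hp.2.trans h1)) (J₁_two_ellK_nonpos hk hz h)

end EulerElastica

end

/-- The first conjuncts say that `k₀`, `p_1^1`, `p_2^1`, `p_1^{x₁}` and the minimum `p_1^conj` are
well defined; the others are the bounds and the signs of `J₁`. -/
theorem mainTheorem6 :
    {k : ℝ | k ∈ Set.Ico (0 : ℝ) 1 ∧ 2 * EulerElastica.ellE k - EulerElastica.ellK k = 0}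
        = {EulerElastica.k₀} ∧
    EulerElastica.k₀ ∈ Set.Ioo (0 : ℝ) 1 ∧
    ∀ k : ℝ, k ∈ Set.Ioo (0 : ℝ) 1 →
      EulerElastica.rootsF₁ k 1 = {EulerElastica.pF₁ k 1} ∧
      EulerElastica.rootsF₁ k 2 = {EulerElastica.pF₁ k 2} ∧
      EulerElastica.rootsX₁ k 1 = {EulerElastica.pX₁ k 1} ∧
      (∀ z : ℝ, z ∈ Set.Icc (0 : ℝ) 1 →
        IsLeast (EulerElastica.rootsJ₁ k z) (EulerElastica.pConj k z) ∧
        (k < EulerElastica.k₀ →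
          EulerElastica.pConj k z ∈ Set.Icc (2 * EulerElastica.ellK k) (EulerElastica.pF₁ k 1)) ∧
        (k = EulerElastica.k₀ →
          EulerElastica.pConj k z = 2 * EulerElastica.ellK k ∧
          2 * EulerElastica.ellK k = EulerElastica.pF₁ k 1) ∧
        (EulerElastica.k₀ < k →
          EulerElastica.pConj k z ∈
            Set.Icc (EulerElastica.pF₁ k 1) (2 * EulerElastica.ellK k))) ∧
      ∃ ε : ℝ, 0 < ε ∧ ∀ z : ℝ, z ∈ Set.Icc (0 : ℝ) 1 →
        (k < EulerElastica.k₀ →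
          (∀ p ∈ Set.Ioo 0 (2 * EulerElastica.ellK k), 0 < EulerElastica.J₁ k z p) ∧
          (∀ p ∈ Set.Ioo (EulerElastica.pF₁ k 1) (EulerElastica.pF₁ k 1 + ε),
            EulerElastica.J₁ k z p < 0)) ∧
        (k = EulerElastica.k₀ →
          (∀ p ∈ Set.Ioo 0 (2 * EulerElastica.ellK k), 0 < EulerElastica.J₁ k z p) ∧
          (∀ p ∈ Set.Ioo (2 * EulerElastica.ellK k) (2 * EulerElastica.ellK k + ε),
            EulerElastica.J₁ k z p < 0)) ∧
        (EulerElastica.k₀ < k →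
          (∀ p ∈ Set.Ioo 0 (EulerElastica.pF₁ k 1), 0 < EulerElastica.J₁ k z p) ∧
          (EulerElastica.pX₁ k 1 ∈
              Set.Ioo (EulerElastica.pF₁ k 1) (2 * EulerElastica.ellK k) →
            ∀ p ∈ Set.Ioo (EulerElastica.pX₁ k 1) (EulerElastica.pX₁ k 1 + ε),
              EulerElastica.J₁ k z p < 0) ∧
          (EulerElastica.pX₁ k 1 = 2 * EulerElastica.ellK k →
            EulerElastica.J₁ k z (2 * EulerElastica.ellK k) ≤ 0) ∧
          (EulerElastica.pX₁ k 1 ∈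
              Set.Ioo (2 * EulerElastica.ellK k) (EulerElastica.pF₁ k 2) →
            ∀ p ∈ Set.Ioo (2 * EulerElastica.ellK k) (2 * EulerElastica.ellK k + ε),
              EulerElastica.J₁ k z p < 0)) := by
  refine ⟨EulerElastica.roots_two_ellE_sub_ellK.1, EulerElastica.roots_two_ellE_sub_ellK.2,
    fun k hk => ?_⟩
  have hk' : k ∈ Set.Ico (0 : ℝ) 1 := ⟨hk.1.le, hk.2⟩
  refine ⟨EulerElastica.rootsF₁_one_eq hk', EulerElastica.rootsF₁_two_eq hk',
    EulerElastica.rootsX₁_one_eq hk, ?_⟩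
  rcases lt_trichotomy k EulerElastica.k₀ with h | h | h
  · have h1 := EulerElastica.two_ellK_lt_pF₁ hk h
    refine ⟨fun z hz => ?_, ?_⟩
    · have h2 := EulerElastica.isLeast_pConj_of_le hk hz h1.le
      exact ⟨h2.1, fun _ => h2.2, fun h' => absurd h' h.ne, fun h' => absurd h' h.not_gt⟩
    · obtain ⟨ε, hε, hneg⟩ := EulerElastica.exists_J₁_neg_right_pF₁ hk h1.le
      exact ⟨ε, hε, fun z hz => ⟨fun _ => ⟨fun p hp =>
        EulerElastica.J₁_pos_of_lt hk hz hp.1 (hp.2.trans h1) hp.2, hneg z hz⟩,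
        fun h' => absurd h' h.ne, fun h' => absurd h' h.not_gt⟩⟩
  · have h1 := EulerElastica.two_ellK_eq_pF₁ hk h
    refine ⟨fun z hz => ?_, ?_⟩
    · have h2 := EulerElastica.isLeast_pConj_of_le hk hz h1.le
      exact ⟨h2.1, fun h' => absurd h h'.ne,
        fun _ => ⟨le_antisymm (h2.2.2.trans_eq h1.symm) h2.2.1, h1⟩, fun h' => absurd h h'.ne'⟩
    · obtain ⟨ε, hε, hneg⟩ := EulerElastica.exists_J₁_neg_right_pF₁ hk h1.le
      rw [← h1] at hneg
      exact ⟨ε, hε, fun z hz => ⟨fun h' => absurd h h'.ne, fun _ => ⟨fun p hp =>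
        EulerElastica.J₁_pos_of_lt hk hz hp.1 (hp.2.trans_eq h1) hp.2, hneg z hz⟩,
        fun h' => absurd h h'.ne'⟩⟩
  · have h1 := EulerElastica.pF₁_lt_two_ellK hk h
    refine ⟨fun z hz => ?_, ?_⟩
    · have h2 := EulerElastica.isLeast_pConj_of_k₀_lt hk hz h
      exact ⟨h2.1, fun h' => absurd h' h.not_gt, fun h' => absurd h' h.ne', fun _ => h2.2⟩
    · have hpos : ∀ z ∈ Set.Icc (0 : ℝ) 1, ∀ p ∈ Set.Ioo 0 (EulerElastica.pF₁ k 1),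
          0 < EulerElastica.J₁ k z p := fun z hz p hp =>
        EulerElastica.J₁_pos_of_lt hk hz hp.1 hp.2 (hp.2.trans h1)
      rcases lt_trichotomy (EulerElastica.pX₁ k 1) (2 * EulerElastica.ellK k) with hX | hX | hX
      · obtain ⟨ε, hε, hneg⟩ := EulerElastica.exists_J₁_neg_right_pX₁ hk hX
        exact ⟨ε, hε, fun z hz => ⟨fun h' => absurd h' h.not_gt, fun h' => absurd h' h.ne',
          fun _ => ⟨hpos z hz, fun _ => hneg z hz, fun h' => absurd h' hX.ne,
            fun h' => absurd h'.1 hX.not_gt⟩⟩⟩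
      -- In this borderline case no clause that mentions ε applies, so any positive value will do.
      · exact ⟨1, one_pos, fun z hz => ⟨fun h' => absurd h' h.not_gt, fun h' => absurd h' h.ne',
          fun _ => ⟨hpos z hz, fun h' => absurd hX h'.2.ne,
            fun _ => EulerElastica.J₁_two_ellK_nonpos hk hz h, fun h' => absurd hX h'.1.ne'⟩⟩⟩
      · obtain ⟨ε, hε, hneg⟩ := EulerElastica.exists_J₁_neg_right_two_ellK hk h1 hX
        exact ⟨ε, hε, fun z hz => ⟨fun h' => absurd h' h.not_gt, fun h' => absurd h' h.ne',
          fun _ => ⟨hpos z hz, fun h' => absurd h'.2 hX.not_gt, fun h' => absurd h' hX.ne',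
            fun _ => hneg z hz⟩⟩⟩
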